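/- Let $\mathcal T$ be a finite three-dimensional triangulation: a finite collection of tetrahedra identified along sub-simplices, with finite vertex set $V$, edge set $E$ and tetrahedron set $T$, in which every edge has two distinct endpoints. It need not be a simplicial complex (several edges may have the same endpoints). In particular, $\mathcal T$ may be such a triangulation of a closed three-manifold. A *metric* is a vector $\ell\in\mathbb R^{E}$ such that every simplex can be realized as a nondegenerate Euclidean simplex with edge lengths given by $\ell$. For a metric $\ell$ let $\beta_{e<t}$ be the dihedral angle of the tetrahedron $t$ at its edge $e$, and put $$K_e=\Big(2\pi-\sum_{t>e}\beta_{e<t}\Big)\ell_e,\quad K_v=\tfrac12\sum_{e>v}K_e,\quad L_v=\tfrac12\sum_{e>v}\ell_e,\quad \mathcal L=\sum_{e\in E}\ell_e,\quad \mathcal{LEHR}=\frac{\sum_{e\in E}K_e}{\mathcal L}.$$ The metric has *constant $\mathcal L$-scalar curvature* if there is $\lambda\in\mathbb R$ with $K_v=\lambda L_v$ for all $v\in V$. For a face $f$ of a tetrahedron $t$, let $h_{f<t}$ be the signed distance from the circumcenter of $t$ to the plane of $f$, positive on the side of the vertex of $t$ not in $f$; for an edge $e$ of $f$, let $h_{e<f}$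 be the signed distance, in the plane of $f$, from the circumcenter of $f$ to the line of $e$, positive on the side of the vertex of $f$ not in $e$. The *dual length* of $e$ is $$\ell_e^*=\sum_{t>e}\tfrac12\big(h_{e<f}h_{f<t}+h_{e<f'}h_{f'<t}\big),$$ where $f,f'$ are the two faces of $t$ containing $e$. Fix a metric $(L_e)_{e\in E}$ and for $f\in\mathbb R^{V}$ put $\ell_e(f)=\exp\big(\tfrac12(f_v+f_{v'})\big)L_e$, where $v,v'$ are the endpoints of $e$. **Proposition 4.16 (Hessian of $\mathcal{LEHR}$ at a constant $\mathcal L$-scalar curvature metric).** Let $f\in\mathbb R^V$ be such that $\ell(f)$ is a metric of constant $\mathcal L$-scalar curvature. Then $\ell(g)$ is a metric for all $g$ near $f$, the function $g\mapsto\mathcal{LEHR}(\ell(g))$ is $C^2$ at $f$, and for all $v,v'\in V$ $$\frac{\partial^2\mathcal{LEHR}}{\partial f_v\,\partial f_{v'}}=-\frac{2}{\mathcal L}\,\Delta_{vv'}+\frac1{\mathcal L}\,N_{vv'}$$ at $f$, with all quantities on the right evaluated at the metric $\ell(f)$, where $$\Delta_{vv'}=\begin{cases}\displaystyle\sum_{e=vv'}\frac{\ell_e^*}{\ell_e}&\text{if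 }v\ne v',\\[2mm]\displaystyle-\sum_{e>v}\frac{\ell_e^*}{\ell_e}&\text{if }v=v',\end{cases}\qquad N_{vv'}=\begin{cases}\displaystyle\sum_{e=vv'}\tfrac14\big(K_e-\mathcal{LEHR}\cdot\ell_e\big)&\text{if }v\ne v',\\[2mm]\tfrac12\big(K_v-\mathcal{LEHR}\cdot L_v\big)&\text{if }v=v'.\end{cases}$$ Here $\sum_{e=vv'}$ runs over the edges with endpoints $v$ and $v'$; it is a single term if there is exactly one such edge and $0$ if there is none. (When $E=\varnothing$ all quotients by $\mathcal L=0$ are read as $0$.) -/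

import Mathlib

open scoped BigOperators Topology

noncomputable section

namespace Tetra

/-- The endpoints of the local edge `a` are the corners `iv a` and `jv a`. -/
def iv : Fin 6 → Fin 4 := ![0, 0, 0, 1, 1, 2]

/-- The endpoints of the local edge `a` are the corners `iv a` and `jv a`. -/
def jv : Fin 6 → Fin 4 := ![1, 2, 3, 2, 3, 3]

/-- The two corners not on the local edge `a` are `kv a` and `lv a`. -/
def kv : Fin 6 → Fin 4 := ![2, 1, 1, 0, 0, 0]

/-- The two corners not on the local edge `a` are `kv a` and `lv a`. -/
def lv : Fin 6 → Fin 4 := ![3, 3, 2, 3, 2, 1]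

end Tetra

/-- The combinatorial data of a finite collection of tetrahedra identified along sub-simplices:
`V`, `E`, `T` are the sets of vertices, edges and tetrahedra.  Every edge joins two distinct
vertices; several edges may join the same two vertices, and several tetrahedra may share all of
their vertices or edges, so this need not be a simplicial complex. The corners of a tetrahedron are
numbered by `Fin 4` and its six edges by `Fin 6`, in the order `01, 02, 03, 12, 13, 23`.
Every finite triangulation of a three-manifold (with edges joining distinct vertices) has such data;
neither the identifications of faces nor the manifold condition enters the quantities below. -/
structure Triangulation3 (V E T : Type*) where
  /-- the unordered pair of endpoints of an edge -/
  ends : E → Sym2 V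
  ends_ne : ∀ e, ¬ (ends e).IsDiag
  /-- the four vertices of a tetrahedron -/
  vert : T → Fin 4 → V
  /-- the six edges of a tetrahedron -/
  edge : T → Fin 6 → E
  ends_edge : ∀ t a, ends (edge t a) =
    s(vert t (Tetra.iv a), vert t (Tetra.jv a))

/-- Euclidean three-space. -/
abbrev E3 : Type := EuclideanSpace ℝ (Fin 3)

/-- A nondegenerate tetrahedron in Euclidean three-space. -/
abbrev Tetra : Type := Affine.Simplex ℝ E3 3

instance nonempty_tetra : Nonempty Tetra := by
  obtain ⟨b⟩ := AffineBasis.exists_affineBasis_of_finiteDimensional (k := ℝ) (P := E3)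
    (ι := Fin 4) (by simp)
  exact ⟨⟨b, b.ind⟩⟩

namespace Tetra

/-- The line through the local edge `a`. -/
def edgeLine (s : Tetra) (a : Fin 6) : AffineSubspace ℝ E3 :=
  line[ℝ, s.points (iv a), s.points (jv a)]

instance (s : Tetra) (a : Fin 6) : Nonempty (s.edgeLine a) :=
  ⟨⟨s.points (iv a), left_mem_affineSpan_pair ℝ _ _⟩⟩

/-- The component of `p` orthogonal to the local edge `a`. -/
def perp (s : Tetra) (a : Fin 6) (p : E3) : E3 :=
  p -ᵥ (EuclideanGeometry.orthogonalProjection (s.edgeLine a) p : E3)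

/-- The dihedral angle at the local edge `a`: the angle between the perpendiculars to the edge that
point into the two faces containing it. -/
def dihedral (s : Tetra) (a : Fin 6) : ℝ :=
  InnerProductGeometry.angle (s.perp a (s.points (kv a))) (s.perp a (s.points (lv a)))

/-- `h_{f<t}` for the face `f` opposite the corner `m`: the signed distance from the circumcenter of
the tetrahedron to the plane of `f`, positive on the side of the corner `m`. -/
def faceHeight (s : Tetra) (m : Fin 4) : ℝ :=
  s.signedInfDist m s.circumcenter

/-- `h_{e<f}` for the local edge `a` in the face `f` that is opposite the corner `m` and whose third
corner is `n`: the signed distance, in the plane of `f`, from the circumcenter of `f`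
to the line of the edge, positive on the side of the corner `n`. -/
def edgeHeight (s : Tetra) (a : Fin 6) (n m : Fin 4) : ℝ :=
  (s.edgeLine a).signedInfDist (s.points n) (s.faceOpposite m).circumcenter

/-- The contribution `(h_{e<f} h_{f<t} + h_{e<f'} h_{f'<t}) / 2` of one tetrahedron to the dual
length of its local edge `a`. -/
def dualContribution (s : Tetra) (a : Fin 6) : ℝ :=
  1 / 2 * (s.edgeHeight a (kv a) (lv a) * s.faceHeight (lv a) +
    s.edgeHeight a (lv a) (kv a) * s.faceHeight (kv a))

end Tetra

namespace Triangulation3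

variable {V E T : Type*} (𝒯 : Triangulation3 V E T)

/-- The Euclidean tetrahedron `s` has the edge lengths that `ℓ` prescribes for `t`. -/
def Realizes (ℓ : E → ℝ) (t : T) (s : Tetra) : Prop :=
  ∀ a : Fin 6, dist (s.points (Tetra.iv a)) (s.points (Tetra.jv a)) = ℓ (𝒯.edge t a)

/-- `ℓ` is a metric: every simplex is realized by a nondegenerate Euclidean simplex with edge
lengths given by `ℓ`. -/
def IsMetric (ℓ : E → ℝ) : Prop :=
  (∀ e, 0 < ℓ e) ∧ ∀ t, ∃ s : Tetra, 𝒯.Realizes ℓ t s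

/-- A Euclidean tetrahedron with the edge lengths prescribed for `t`. It exists when `ℓ` is a metric
and is then unique up to congruence. -/
def realization (ℓ : E → ℝ) (t : T) : Tetra :=
  Classical.epsilon (𝒯.Realizes ℓ t)

/-- The partial derivative `∂F/∂f_v` of a function on the real-valued functions on `V`. -/
def partialDeriv [Fintype V] [DecidableEq V] (F : (V → ℝ) → ℝ) (v : V) (f : V → ℝ) : ℝ :=
  lineDeriv ℝ F f (Pi.single v 1)

/-- The conformal change `ℓ_e(f) = exp((f_v + f_{v'}) / 2) L_e`, for `e` joining `v` and `v'`. -/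
def conformal (L : E → ℝ) (f : V → ℝ) (e : E) : ℝ :=
  Real.exp (1 / 2 * Sym2.lift ⟨fun v w => f v + f w, fun _ _ => add_comm _ _⟩ (𝒯.ends e)) * L e

section

variable [Fintype T] [DecidableEq E]

/-- The edge curvature `K_e`. -/
def edgeCurv (ℓ : E → ℝ) (e : E) : ℝ :=
  (2 * Real.pi - ∑ t : T, ∑ a : Fin 6 with 𝒯.edge t a = e, (𝒯.realization ℓ t).dihedral a) * ℓ e

/-- The dual length `ℓ*_e`. -/
def dualLength (ℓ : E → ℝ) (e : E) : ℝ :=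
  ∑ t : T, ∑ a : Fin 6 with 𝒯.edge t a = e, (𝒯.realization ℓ t).dualContribution a

variable [Fintype E]

/-- The total length. -/
def totalLength (ℓ : E → ℝ) : ℝ := ∑ e, ℓ e

/-- The Einstein-Hilbert-Regge functional. -/
def EHR (ℓ : E → ℝ) : ℝ := ∑ e, 𝒯.edgeCurv ℓ e

/-- The length normalized Einstein-Hilbert-Regge functional. -/
def LEHR (ℓ : E → ℝ) : ℝ := 𝒯.EHR ℓ / totalLength ℓ

end

section

variable [Fintype E] [DecidableEq V]

/-- `L_v`, half the total length of the edges at `v`. -/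
def vertexLength (ℓ : E → ℝ) (v : V) : ℝ := 1 / 2 * ∑ e with v ∈ 𝒯.ends e, ℓ e

variable [Fintype T] [DecidableEq E]

/-- The vertex curvature `K_v`. -/
def vertexCurv (ℓ : E → ℝ) (v : V) : ℝ := 1 / 2 * ∑ e with v ∈ 𝒯.ends e, 𝒯.edgeCurv ℓ e

/-- `ℓ` has constant `𝓛`-scalar curvature: `K_v = c L_v` for a constant `c` and all `v`. -/
def ConstLScalarCurv (ℓ : E → ℝ) : Prop :=
  ∃ c : ℝ, ∀ v, 𝒯.vertexCurv ℓ v = c * 𝒯.vertexLength ℓ v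

/-- The Laplacian matrix. The off-diagonal entry is the sum over the edges joining `v` and `w`. -/
def laplacian (ℓ : E → ℝ) : Matrix V V ℝ := Matrix.of fun v w =>
  if v = w then -∑ e with v ∈ 𝒯.ends e, 𝒯.dualLength ℓ e / ℓ e
  else ∑ e with 𝒯.ends e = s(v, w), 𝒯.dualLength ℓ e / ℓ e

/-- The matrix `N`. The off-diagonal entry is the sum over the edges joining `v` and `w`. -/
def nMatrix (ℓ : E → ℝ) : Matrix V V ℝ := Matrix.of fun v w =>
  if v = w then 1 / 2 * (𝒯.vertexCurv ℓ v - 𝒯.LEHR ℓ * 𝒯.vertexLength ℓ v)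
  else ∑ e with 𝒯.ends e = s(v, w), 1 / 4 * (𝒯.edgeCurv ℓ e - 𝒯.LEHR ℓ * ℓ e)

end

end Triangulation3

end

/-! Under a conformal variation the length-weighted variations of the dihedral angles cancel in
every tetrahedron (Schläfli), so `∂EHR/∂f_v = K_v`, `∂𝓛/∂f_v = L_v`, and the gradient of `LEHR` is
`(K_v 𝓛 - EHR L_v) / 𝓛²`. Summing `K_v = λ L_v` over the vertices forces `λ = LEHR`. At such a
metric the numerator vanishes and the cross terms of its derivative cancel, so the Hessian is `(∂K_v
- LEHR ∂L_v) / 𝓛`. Differentiating the lengths in `K_v` and `L_v` gives `N`; differentiating the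
angles in `K_v` must give `-2Δ`.

The angle term is a statement about one tetrahedron, `exists_hasDerivAt_dihedral`. It is proved in
terms of the Gram matrix `M` of the gradients of the barycentric coordinates and the barycentric
coordinates `c` of the circumcenter. Angles (`dihedral_eq`), lengths (`dist_eq`) and dual lengths
(`dualContribution_div_dist`) are explicit in `M` and `c`. The blocks `-M/2`, `c` and `-2R²` form
the inverse Cayley-Menger matrix, which gives smoothness in the squared lengths and the closed
formula `hasDerivAt_gradGram` for the variation of `M`. The rest is algebra of symmetric matrices
with zero column sums: `sum_edges_gram_variation` and `sum_edges_laplacian_identity`.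

Being a metric is an open condition because realizability of six lengths amounts to positive
definiteness of a Gram matrix (`eventually_exists_edgeLengths_eq`). -/

noncomputable section

/-! ### Gradients of barycentric coordinates and their Gram matrix -/

namespace Tetra

/-- The corners of a nondegenerate tetrahedron as an affine basis. -/
def affineBasis (s : Tetra) : AffineBasis (Fin 4) ℝ E3 :=
  ⟨s.points, s.independent,
    s.independent.affineSpan_eq_top_iff_card_eq_finrank_add_one.2 (by simp)⟩

/-- The gradient of the barycentric coordinate of the corner `i`. -/
def grad (s : Tetra) (i : Fin 4) : E3 :=
  (InnerProductSpace.toDual ℝ E3).symm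
    (LinearMap.toContinuousLinearMap (s.affineBasis.coord i).linear)

/-- The barycentric coordinates of the circumcenter. -/
def centerCoord (s : Tetra) (i : Fin 4) : ℝ := s.affineBasis.coord i s.circumcenter

/-- The matrix of inner products of the gradients of the barycentric coordinates. -/
def gradGram (s : Tetra) (i j : Fin 4) : ℝ := inner ℝ (s.grad i) (s.grad j)

variable (s : Tetra)

lemma inner_grad (i : Fin 4) (x y : E3) :
    inner ℝ (s.grad i) (x - y) = s.affineBasis.coord i x - s.affineBasis.coord i y := by
  rw [grad, InnerProductSpace.toDual_symm_apply, LinearMap.coe_toContinuousLinearMap',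
    ← vsub_eq_sub x y, AffineMap.linearMap_vsub, vsub_eq_sub]

lemma coord_points (i j : Fin 4) :
    s.affineBasis.coord i (s.points j) = if i = j then 1 else 0 :=
  s.affineBasis.coord_apply i j

lemma inner_grad_points (i j k : Fin 4) :
    inner ℝ (s.grad i) (s.points j - s.points k) =
      (if i = j then 1 else 0) - (if i = k then 1 else 0) := by
  rw [inner_grad, coord_points, coord_points]

lemma sum_grad : ∑ i, s.grad i = 0 := by
  refine ext_inner_right ℝ fun v => ?_
  have h := fun i => s.inner_grad i v 0
  simp only [sub_zero] at h
  rw [sum_inner]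
  simp only [h, Finset.sum_sub_distrib, AffineBasis.sum_coord_apply_eq_one]
  simp

lemma eq_zero_of_inner_grad {v : E3} (h : ∀ i, inner ℝ (s.grad i) v = 0) : v = 0 := by
  refine s.affineBasis.ext_elem fun i => ?_
  have := s.inner_grad i v 0
  rw [sub_zero, h] at this
  linarith

lemma sum_inner_grad (v : E3) : ∑ i, inner ℝ (s.grad i) v = 0 := by
  rw [← sum_inner, sum_grad, inner_zero_left]

/-- The pairings with the gradients are the barycentric weights of a vector; they sum to zero, so
the base point `o` is arbitrary. -/
lemma sum_inner_grad_smul (v o : E3) :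
    ∑ i, inner ℝ (s.grad i) v • (s.points i - o) = v := by
  have key : ∑ i, inner ℝ (s.grad i) v • (s.points i - s.points 0) = v := by
    refine sub_eq_zero.1 (s.eq_zero_of_inner_grad fun k => ?_)
    rw [inner_sub_right, inner_sum]
    simp only [inner_smul_right, inner_grad_points, mul_sub, Finset.sum_sub_distrib,
      ← Finset.sum_mul, sum_inner_grad]
    simp
  have : ∀ i, inner ℝ (s.grad i) v • (s.points i - o) =
      inner ℝ (s.grad i) v • (s.points i - s.points 0) +
        inner ℝ (s.grad i) v • (s.points 0 - o) := fun i => by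
    rw [← smul_add, sub_add_sub_cancel]
  rw [Finset.sum_congr rfl fun i _ => this i, Finset.sum_add_distrib, key, ← Finset.sum_smul,
    sum_inner_grad, zero_smul, add_zero]

lemma gradGram_comm (i j : Fin 4) : s.gradGram i j = s.gradGram j i := real_inner_comm _ _

lemma sum_gradGram (j : Fin 4) : ∑ i, s.gradGram i j = 0 := by
  simp only [gradGram, ← sum_inner, sum_grad, inner_zero_left]

lemma sum_centerCoord : ∑ i, s.centerCoord i = 1 :=
  s.affineBasis.sum_coord_apply_eq_one _

lemma dist_sq_eq_circumradius (i k : Fin 4) :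
    dist (s.points i) (s.points k) ^ 2 = 2 * s.circumradius ^ 2 -
      2 * inner ℝ (s.points i - s.circumcenter) (s.points k - s.circumcenter) := by
  have h1 := s.dist_circumcenter_eq_circumradius i
  have h2 := s.dist_circumcenter_eq_circumradius k
  rw [dist_eq_norm] at h1 h2 ⊢
  rw [← sub_sub_sub_cancel_right _ _ s.circumcenter, norm_sub_sq_real, h1, h2]
  ring

lemma sum_dist_sq_mul_centerCoord (i : Fin 4) :
    ∑ k : Fin 4, dist (s.points i) (s.points k) ^ 2 * s.centerCoord k =
      2 * s.circumradius ^ 2 := by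
  have h : ∑ k : Fin 4, s.centerCoord k • (s.points k - s.circumcenter) = 0 := by
    simp only [smul_sub, Finset.sum_sub_distrib, ← Finset.sum_smul, sum_centerCoord, one_smul]
    exact sub_eq_zero.2 (s.affineBasis.linear_combination_coord_eq_self s.circumcenter)
  have h' := congrArg (fun v => inner ℝ (s.points i - s.circumcenter) v) h
  simp only [inner_sum, inner_smul_right, inner_zero_right] at h'
  have : ∀ k : Fin 4, dist (s.points i) (s.points k) ^ 2 * s.centerCoord k =
      2 * s.circumradius ^ 2 * s.centerCoord k - 2 * (s.centerCoord k *
      inner ℝ (s.points i - s.circumcenter) (s.points k - s.circumcenter)) := fun k => by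
    rw [dist_sq_eq_circumradius]; ring
  simp only [this, Finset.sum_sub_distrib, ← Finset.mul_sum, sum_centerCoord, h']
  ring

/-- The squared distances are inverse to `gradGram` in the sense of bordered matrices. -/
lemma sum_dist_sq_mul_gradGram (i j : Fin 4) :
    ∑ k : Fin 4, dist (s.points i) (s.points k) ^ 2 * s.gradGram k j =
      2 * s.centerCoord j - (if i = j then 2 else 0) := by
  have hd := s.dist_sq_eq_circumradius i
  -- Centering at the circumcenter makes all corners equidistant, so squared distances become inner
  -- products up to a constant that the zero column sums of `gradGram` remove.
  have h : ∑ k, s.gradGram k j • (s.points k - s.circumcenter) = s.grad j :=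
    s.sum_inner_grad_smul _ _
  have h' : ∑ k, s.gradGram k j *
      inner ℝ (s.points i - s.circumcenter) (s.points k - s.circumcenter) =
      (if j = i then 1 else 0) - s.centerCoord j := by
    rw [← coord_points, centerCoord, ← inner_grad, real_inner_comm, ← h, inner_sum]
    simp only [inner_smul_right]
  have : ∀ k : Fin 4, dist (s.points i) (s.points k) ^ 2 * s.gradGram k j =
      2 * s.circumradius ^ 2 * s.gradGram k j - 2 * (s.gradGram k j *
      inner ℝ (s.points i - s.circumcenter) (s.points k - s.circumcenter)) := fun k => by
    rw [hd]; ring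
  simp only [this, Finset.sum_sub_distrib, ← Finset.mul_sum, sum_gradGram, h']
  simp only [eq_comm (a := i)]
  split_ifs <;> ring

lemma gradGram_self_pos (i : Fin 4) : 0 < s.gradGram i i := by
  refine real_inner_self_pos.2 fun h => ?_
  obtain ⟨j, hj⟩ : ∃ j, i ≠ j := ⟨i + 1, by fin_cases i <;> decide⟩
  have := s.inner_grad_points i i j
  simp [h, hj] at this

lemma gradGram_minor_pos {i j : Fin 4} (h : i ≠ j) :
    0 < s.gradGram i i * s.gradGram j j - s.gradGram i j ^ 2 := by
  obtain ⟨k, hik, hjk⟩ : ∃ k, i ≠ k ∧ j ≠ k := by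
    revert i j; decide
  have hj := s.gradGram_self_pos j
  -- A multiple of the component of `grad i` orthogonal to `grad j`. Pairing it with an edge vector
  -- from a third corner to `i` leaves `gradGram j j`, so it is nonzero.
  have hv : s.gradGram j j • s.grad i - s.gradGram i j • s.grad j ≠ 0 := fun h0 => by
    have := congrArg (fun v => inner ℝ v (s.points i - s.points k)) h0
    simp [inner_sub_left, inner_smul_left, inner_grad_points, hik, hjk, h.symm] at this
    exact hj.ne' this
  have h1 := real_inner_self_pos.2 hv
  have h2 : inner ℝ (s.gradGram j j • s.grad i - s.gradGram i j • s.grad j)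
      (s.gradGram j j • s.grad i - s.gradGram i j • s.grad j) =
      s.gradGram j j * (s.gradGram i i * s.gradGram j j - s.gradGram i j ^ 2) := by
    simp only [inner_sub_left, inner_sub_right, real_inner_smul_left, real_inner_smul_right]
    rw [real_inner_comm (s.grad i) (s.grad j)]
    simp only [gradGram]
    ring
  rw [h2] at h1
  exact pos_of_mul_pos_right h1 hj.le

end Tetra

/-! ### Dihedral angles, heights and dual lengths in terms of the Gram matrix -/

namespace Tetra

lemma sum_of_nodup {A : Type*} [AddCommMonoid A] {i j k l : Fin 4} (h : [i, j, k, l].Nodup)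
    (F : Fin 4 → A) : ∑ m, F m = F i + F j + F k + F l := by
  have hu : (Finset.univ : Finset (Fin 4)) = {i, j, k, l} := by revert i j k l; decide
  simp only [List.nodup_cons, List.mem_cons, List.not_mem_nil, or_false, not_or] at h
  obtain ⟨⟨hij, hik, hil⟩, ⟨hjk, hjl⟩, hkl, -⟩ := h
  rw [hu, Finset.sum_insert (by simp [*]), Finset.sum_insert (by simp [*]),
    Finset.sum_insert (by simp [*]), Finset.sum_singleton, add_assoc, add_assoc]

lemma nodup_corners (a : Fin 6) : [iv a, jv a, kv a, lv a].Nodup := by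
  revert a; decide

lemma nodup_corners' (a : Fin 6) : [iv a, jv a, lv a, kv a].Nodup := by
  revert a; decide

variable (s : Tetra)

/-- The squared area of the parallelogram spanned by two gradients of barycentric coordinates. -/
def gradMinor (k l : Fin 4) : ℝ := s.gradGram k k * s.gradGram l l - s.gradGram k l ^ 2

lemma gradMinor_comm (k l : Fin 4) : s.gradMinor k l = s.gradMinor l k := by
  rw [gradMinor, gradMinor, s.gradGram_comm k l, mul_comm]

lemma gradMinor_pos {k l : Fin 4} (h : k ≠ l) : 0 < s.gradMinor k l := s.gradGram_minor_pos h

/-- The component of `points k` orthogonal to the edge opposite to `k` and `l`. -/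
def perpVec (k l : Fin 4) : E3 :=
  (s.gradMinor k l)⁻¹ • (s.gradGram l l • s.grad k - s.gradGram k l • s.grad l)

lemma inner_perpVec (k l : Fin 4) (v : E3) : inner ℝ (s.perpVec k l) v =
    (s.gradMinor k l)⁻¹ * (s.gradGram l l * inner ℝ (s.grad k) v -
      s.gradGram k l * inner ℝ (s.grad l) v) := by
  simp only [perpVec, real_inner_smul_left, inner_sub_left]

lemma inner_grad_perpVec {k l : Fin 4} (h : k ≠ l) :
    inner ℝ (s.grad k) (s.perpVec k l) = 1 := by
  rw [real_inner_comm, inner_perpVec, inv_mul_eq_one₀ (s.gradMinor_pos h).ne', gradMinor]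
  change _ = s.gradGram l l * s.gradGram k k - s.gradGram k l * s.gradGram l k
  rw [s.gradGram_comm l k]
  ring

lemma inner_grad_perpVec' (k l : Fin 4) :
    inner ℝ (s.grad l) (s.perpVec k l) = 0 := by
  rw [real_inner_comm, inner_perpVec]
  change _ * (s.gradGram l l * s.gradGram k l - s.gradGram k l * s.gradGram l l) = 0
  ring

lemma inner_perpVec_self {k l : Fin 4} (h : k ≠ l) :
    inner ℝ (s.perpVec k l) (s.perpVec k l) = s.gradGram l l / s.gradMinor k l := by
  rw [inner_perpVec, inner_grad_perpVec s h, inner_grad_perpVec']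
  ring

lemma inner_perpVec_swap {k l : Fin 4} (h : k ≠ l) :
    inner ℝ (s.perpVec k l) (s.perpVec l k) = - s.gradGram k l / s.gradMinor k l := by
  rw [inner_perpVec, inner_grad_perpVec s h.symm, inner_grad_perpVec']
  ring

lemma norm_perpVec {k l : Fin 4} (h : k ≠ l) :
    ‖s.perpVec k l‖ = √(s.gradGram l l / s.gradMinor k l) := by
  rw [norm_eq_sqrt_real_inner, inner_perpVec_self s h]

/-- `perpVec k l` combines two gradients that are orthogonal to the edge, and its coordinates at `k`
and `l` are 1 and 0, so subtracting it from `points k` lands on the edge line. -/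
lemma perp_of_nodup {a : Fin 6} {k l : Fin 4} (h : [iv a, jv a, k, l].Nodup) :
    s.perp a (s.points k) = s.perpVec k l := by
  have hs := fun v o => (sum_of_nodup h _).symm.trans (s.sum_inner_grad_smul v o)
  simp only [List.nodup_cons, List.mem_cons, List.not_mem_nil, or_false, not_or] at h
  obtain ⟨⟨hij, hik, hil⟩, ⟨hjk, hjl⟩, hkl, -⟩ := h
  have hmem : s.points k - s.perpVec k l ∈ s.edgeLine a := by
    have := hs (s.points k - s.perpVec k l - s.points (iv a)) (s.points (iv a))
    rw [show s.points k - s.perpVec k l - s.points (iv a) =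
      (s.points k - s.points (iv a)) - s.perpVec k l by abel] at this
    simp only [inner_sub_right _ (s.points k - s.points (iv a)), inner_grad_perpVec s hkl,
      inner_grad_perpVec', inner_grad_points] at this
    simp [Ne.symm hik, Ne.symm hil, Ne.symm hkl] at this
    rw [show s.points k - s.perpVec k l =
      (s.points k - s.points (iv a) - s.perpVec k l) + s.points (iv a) by abel, ← this]
    exact AffineMap.lineMap_mem_affineSpan_pair _ _ _
  have horth : s.points k - (s.points k - s.perpVec k l) ∈ (s.edgeLine a).directionᗮ := by
    rw [sub_sub_cancel, Submodule.mem_orthogonal, edgeLine, direction_affineSpan]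
    intro u hu
    obtain ⟨r, rfl⟩ := mem_vectorSpan_pair.1 hu
    rw [real_inner_comm, inner_smul_right, inner_perpVec, vsub_eq_sub, inner_grad_points,
      inner_grad_points]
    simp [Ne.symm hik, Ne.symm hil, Ne.symm hjk, Ne.symm hjl]
  rw [perp, EuclideanGeometry.coe_orthogonalProjection_eq_iff_mem.2 ⟨hmem, horth⟩, vsub_eq_sub,
    sub_sub_cancel]

/-- The gradients at `k` and `l` are inward normals of the two faces containing the edge, and the
dihedral angle is supplementary to the angle between them. -/
lemma dihedral_eq (a : Fin 6) : s.dihedral a = Real.arccos (-s.gradGram (kv a) (lv a) /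
    √(s.gradGram (kv a) (kv a) * s.gradGram (lv a) (lv a))) := by
  have hkl : kv a ≠ lv a := by revert a; decide
  rw [dihedral, s.perp_of_nodup (nodup_corners a), s.perp_of_nodup (nodup_corners' a),
    InnerProductGeometry.angle, inner_perpVec_swap s hkl, norm_perpVec s hkl,
    norm_perpVec s hkl.symm, s.gradMinor_comm (lv a), ← Real.sqrt_mul
      (div_nonneg (s.gradGram_self_pos _).le (s.gradMinor_pos hkl).le)]
  congr 1
  rw [div_mul_div_comm, Real.sqrt_div' _ (mul_self_nonneg _),
    Real.sqrt_mul_self (s.gradMinor_pos hkl).le, mul_comm (s.gradGram (lv a) (lv a)),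
    div_div_div_cancel_right₀ (s.gradMinor_pos hkl).ne']

lemma mem_affineSpan_face {m : Fin 4} {x : E3} (h : s.affineBasis.coord m x = 0) :
    x ∈ affineSpan ℝ (s.points '' {m}ᶜ) := by
  rw [← s.affineBasis.affineCombination_coord_eq_self x]
  refine affineCombination_mem_affineSpan_image
    (s.affineBasis.sum_coord_apply_eq_one x) (fun i _ hi => ?_) s.points
  rw [Set.notMem_compl_iff, Set.mem_singleton_iff] at hi
  rw [hi, h]

lemma grad_mem_orthogonal (m : Fin 4) :
    s.grad m ∈ (affineSpan ℝ (s.points '' {m}ᶜ)).directionᗮ := by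
  rw [direction_affineSpan, vectorSpan_def, ← Submodule.span_singleton_le_iff_mem,
    Submodule.le_orthogonal_iff_le_orthogonal, Submodule.span_le]
  rintro _ ⟨_, ⟨i, hi, rfl⟩, _, ⟨j, hj, rfl⟩, rfl⟩
  have hi' : m ≠ i := fun h => hi h.symm
  have hj' : m ≠ j := fun h => hj h.symm
  rw [SetLike.mem_coe, Submodule.mem_orthogonal_singleton_iff_inner_right]
  change inner ℝ (s.grad m) (s.points i - s.points j) = 0
  rw [inner_grad_points, if_neg hi', if_neg hj', sub_zero]

lemma coord_sub_smul_grad (i m : Fin 4) (x : E3) (r : ℝ) :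
    s.affineBasis.coord i (x - r • s.grad m) = s.affineBasis.coord i x - r * s.gradGram i m := by
  have h := s.inner_grad i x (x - r • s.grad m)
  rw [sub_sub_cancel, inner_smul_right, ← gradGram] at h
  linarith

/-- A barycentric coordinate is the signed distance to the opposite face divided by the altitude,
and the altitude is `1 / ‖grad m‖`. -/
lemma faceHeight_eq (m : Fin 4) :
    s.faceHeight m = s.centerCoord m / √(s.gradGram m m) := by
  have hM := s.gradGram_self_pos m
  obtain ⟨j, hj⟩ : ∃ j, m ≠ j := ⟨m + 1, by fin_cases m <;> decide⟩
  have hpj : s.points j ∈ affineSpan ℝ (s.points '' {m}ᶜ) :=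
    s.mem_affineSpan_face (by rw [coord_points, if_neg hj])
  have : Nonempty (affineSpan ℝ (s.points '' {m}ᶜ)) := ⟨⟨_, hpj⟩⟩
  have hfoot : (EuclideanGeometry.orthogonalProjection (affineSpan ℝ (s.points '' {m}ᶜ))
      (s.points m) : E3) = s.points m - (s.gradGram m m)⁻¹ • s.grad m := by
    rw [EuclideanGeometry.coe_orthogonalProjection_eq_iff_mem]
    refine ⟨s.mem_affineSpan_face ?_, ?_⟩
    · rw [coord_sub_smul_grad, coord_points, if_pos rfl, inv_mul_cancel₀ hM.ne', sub_self]
    · rw [vsub_eq_sub, sub_sub_cancel]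
      exact Submodule.smul_mem _ _ (s.grad_mem_orthogonal m)
  rw [faceHeight, Affine.Simplex.signedInfDist,
    AffineSubspace.signedInfDist_eq_signedDist_of_mem hpj, signedDist_apply_apply, hfoot,
    vsub_eq_sub, vsub_eq_sub, sub_sub_cancel, NormedSpace.normalize_smul_of_pos (inv_pos.2 hM),
    NormedSpace.normalize, real_inner_smul_left, inner_grad, coord_points, if_neg hj, sub_zero,
    norm_eq_sqrt_real_inner, ← gradGram, ← centerCoord, inv_mul_eq_div]

/-- The circumcenter of a face is the orthogonal projection of the circumcenter of the tetrahedron;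
equidistance is Pythagoras. -/
lemma circumcenter_faceOpposite (m : Fin 4) : (s.faceOpposite m).circumcenter =
    s.circumcenter - (s.centerCoord m / s.gradGram m m) • s.grad m := by
  have hM := s.gradGram_self_pos m
  refine (Affine.Simplex.eq_circumcenter_of_dist_eq
    (r := √(s.circumradius ^ 2 - s.centerCoord m ^ 2 / s.gradGram m m)) _ ?_ fun i => ?_).symm
  · rw [Affine.Simplex.range_faceOpposite_points]
    apply mem_affineSpan_face
    rw [coord_sub_smul_grad, div_mul_cancel₀ _ hM.ne', centerCoord, sub_self]
  · obtain ⟨j, hj, h⟩ : (s.faceOpposite m).points i ∈ s.points '' {m}ᶜ := by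
      rw [← Affine.Simplex.range_faceOpposite_points]
      exact Set.mem_range_self i
    have hj' : m ≠ j := fun h => hj h.symm
    have hsq : dist (s.points j) (s.circumcenter - (s.centerCoord m / s.gradGram m m) • s.grad m)
        ^ 2 = s.circumradius ^ 2 - s.centerCoord m ^ 2 / s.gradGram m m := by
      rw [dist_eq_norm, sub_sub_eq_add_sub, add_sub_right_comm, norm_add_sq_real,
        inner_smul_right, real_inner_comm, inner_grad, coord_points, if_neg hj', ← centerCoord,
        ← dist_eq_norm, s.dist_circumcenter_eq_circumradius, norm_smul, mul_pow,
        ← real_inner_self_eq_norm_sq (s.grad m), ← gradGram, Real.norm_eq_abs, sq_abs]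
      field_simp
      ring
    rw [← h, ← hsq, Real.sqrt_sq dist_nonneg]

/-- The first factor is the altitude `‖perpVec k l‖` of the face, the second the coordinate at `k`
of the circumcenter of the face. -/
lemma edgeHeight_of_nodup {a : Fin 6} {k l : Fin 4} (h : [iv a, jv a, k, l].Nodup) :
    s.edgeHeight a k l = √(s.gradGram l l / s.gradMinor k l) *
      (s.centerCoord k - s.centerCoord l / s.gradGram l l * s.gradGram k l) := by
  have hp := s.perp_of_nodup h
  simp only [List.nodup_cons, List.mem_cons, List.not_mem_nil, or_false, not_or] at h
  obtain ⟨⟨hij, hik, hil⟩, ⟨hjk, hjl⟩, hkl, -⟩ := h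
  have hi : s.points (iv a) ∈ s.edgeLine a := left_mem_affineSpan_pair ℝ _ _
  have hW := div_pos (s.gradGram_self_pos l) (s.gradMinor_pos hkl)
  rw [edgeHeight, AffineSubspace.signedInfDist_eq_signedDist_of_mem hi, signedDist_apply_apply,
    ← perp, hp, NormedSpace.normalize, real_inner_smul_left, inner_perpVec, vsub_eq_sub,
    inner_grad, inner_grad, circumcenter_faceOpposite, coord_sub_smul_grad, coord_sub_smul_grad,
    coord_points, coord_points, if_neg (Ne.symm hik), if_neg (Ne.symm hil), ← centerCoord,
    ← centerCoord, div_mul_cancel₀ _ (s.gradGram_self_pos l).ne', norm_perpVec s hkl,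
    inv_mul_eq_div, div_eq_iff (Real.sqrt_ne_zero'.2 hW), mul_right_comm, Real.mul_self_sqrt hW.le]
  ring

lemma dualContribution_eq (a : Fin 6) : s.dualContribution a =
    1 / 2 * ((s.centerCoord (kv a) - s.centerCoord (lv a) / s.gradGram (lv a) (lv a) *
        s.gradGram (kv a) (lv a)) * s.centerCoord (lv a) +
      (s.centerCoord (lv a) - s.centerCoord (kv a) / s.gradGram (kv a) (kv a) *
        s.gradGram (kv a) (lv a)) * s.centerCoord (kv a)) /
      √(s.gradMinor (kv a) (lv a)) := by
  have hk := Real.sqrt_ne_zero'.2 (s.gradGram_self_pos (kv a))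
  have hl := Real.sqrt_ne_zero'.2 (s.gradGram_self_pos (lv a))
  rw [dualContribution, s.edgeHeight_of_nodup (nodup_corners a),
    s.edgeHeight_of_nodup (nodup_corners' a), faceHeight_eq, faceHeight_eq,
    s.gradMinor_comm (lv a), s.gradGram_comm (lv a) (kv a),
    Real.sqrt_div (s.gradGram_self_pos _).le, Real.sqrt_div (s.gradGram_self_pos _).le]
  generalize √(s.gradMinor (kv a) (lv a)) = δ
  generalize s.centerCoord (kv a) - _ = x
  generalize s.centerCoord (lv a) - _ = y
  field_simp

end Tetra

/-! ### Edge lengths and the ratio of dual length to length -/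

namespace Tetra

variable (s : Tetra)

/-- The Gram determinant of the gradients of three barycentric coordinates. -/
def gradDet : ℝ := s.gradGram 1 1 * (s.gradGram 2 2 * s.gradGram 3 3 - s.gradGram 2 3 ^ 2) -
  s.gradGram 1 2 * (s.gradGram 1 2 * s.gradGram 3 3 - s.gradGram 2 3 * s.gradGram 1 3) +
  s.gradGram 1 3 * (s.gradGram 1 2 * s.gradGram 2 3 - s.gradGram 2 2 * s.gradGram 1 3)

/-- In a symmetric matrix with zero row sums all principal minors of corank one agree, so the
omitted corner does not matter. -/
lemma gradDet_eq {i j k l : Fin 4} (h : [i, j, k, l].Nodup) : s.gradDet =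
    s.gradGram j j * (s.gradGram k k * s.gradGram l l - s.gradGram k l ^ 2) -
    s.gradGram j k * (s.gradGram j k * s.gradGram l l - s.gradGram k l * s.gradGram j l) +
    s.gradGram j l * (s.gradGram j k * s.gradGram k l - s.gradGram k k * s.gradGram j l) := by
  have h0 := s.sum_gradGram 0
  have h1 := s.sum_gradGram 1
  have h2 := s.sum_gradGram 2
  have h3 := s.sum_gradGram 3
  simp only [Fin.sum_univ_four, s.gradGram_comm 1 0, s.gradGram_comm 2 0, s.gradGram_comm 3 0,
    s.gradGram_comm 2 1, s.gradGram_comm 3 1, s.gradGram_comm 3 2] at h0 h1 h2 h3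
  have h0' : s.gradGram 0 0 = -(s.gradGram 0 1 + s.gradGram 0 2 + s.gradGram 0 3) := by linarith
  have h1' : s.gradGram 1 1 = -(s.gradGram 0 1 + s.gradGram 1 2 + s.gradGram 1 3) := by linarith
  have h2' : s.gradGram 2 2 = -(s.gradGram 0 2 + s.gradGram 1 2 + s.gradGram 2 3) := by linarith
  have h3' : s.gradGram 3 3 = -(s.gradGram 0 3 + s.gradGram 1 3 + s.gradGram 2 3) := by linarith
  have hjkl : j ≠ k ∧ j ≠ l ∧ k ≠ l ∧ i ≠ j ∧ i ≠ k ∧ i ≠ l := by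
    revert h; revert i j k l; decide
  clear h
  obtain ⟨a1, a2, a3, a4, a5, a6⟩ := hjkl
  rw [gradDet]
  fin_cases j <;> fin_cases k <;> first | exact absurd rfl a1 | skip
  all_goals fin_cases l <;> first | exact absurd rfl a2 | exact absurd rfl a3 | skip
  all_goals simp only [Fin.zero_eta, Fin.mk_one, Fin.reduceFinMk, s.gradGram_comm 1 0,
    s.gradGram_comm 2 0, s.gradGram_comm 3 0, s.gradGram_comm 2 1, s.gradGram_comm 3 1,
    s.gradGram_comm 3 2, h0', h1', h2', h3'] <;> ring

lemma dist_sq_mul_gradDet {i j k l : Fin 4} (h : [i, j, k, l].Nodup) :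
    dist (s.points i) (s.points j) ^ 2 * s.gradDet = s.gradMinor k l := by
  have hE := fun p q => (sum_of_nodup h _).symm.trans (s.sum_dist_sq_mul_gradGram p q)
  have hM := fun q => (sum_of_nodup h _).symm.trans (s.sum_gradGram q)
  rw [s.gradDet_eq h]
  simp only [List.nodup_cons, List.mem_cons, List.not_mem_nil, or_false, not_or] at h
  obtain ⟨⟨hij, hik, hil⟩, ⟨hjk, hjl⟩, hkl, -⟩ := h
  -- Subtracting the rows `i` and `j` eliminates the circumcenter. With row `i` of `gradGram`
  -- eliminated by its zero column sums, a 3×3 system with right-hand side `(2, 0, 0)` remains,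
  -- whose first unknown is twice the squared distance; Cramer's rule concludes.
  have ej : _ - _ = _ - _ := congrArg₂ (· - ·) (hE i j) (hE j j)
  have ek : _ - _ = _ - _ := congrArg₂ (· - ·) (hE i k) (hE j k)
  have el : _ - _ = _ - _ := congrArg₂ (· - ·) (hE i l) (hE j l)
  have mj := hM j
  have mk := hM k
  have ml := hM l
  simp only [dist_self, dist_comm (s.points j) (s.points i), if_neg hij, if_neg hik, if_neg hil,
    if_neg hjk, if_neg hjl, if_true, s.gradGram_comm k j, s.gradGram_comm l j,
    s.gradGram_comm l k] at ej ek el mj mk ml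
  have mj' := eq_neg_of_add_eq_zero_left ((by linear_combination mj :
    s.gradGram i j + (s.gradGram j j + s.gradGram j k + s.gradGram j l) = 0))
  have mk' := eq_neg_of_add_eq_zero_left ((by linear_combination mk :
    s.gradGram i k + (s.gradGram j k + s.gradGram k k + s.gradGram k l) = 0))
  have ml' := eq_neg_of_add_eq_zero_left ((by linear_combination ml :
    s.gradGram i l + (s.gradGram j l + s.gradGram k l + s.gradGram l l) = 0))
  rw [mj'] at ej
  rw [mk'] at ek
  rw [ml'] at el
  rw [gradMinor]
  linear_combination
    (s.gradGram k k * s.gradGram l l - s.gradGram k l ^ 2) / 2 * ej -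
    (s.gradGram j k * s.gradGram l l - s.gradGram k l * s.gradGram j l) / 2 * ek +
    (s.gradGram j k * s.gradGram k l - s.gradGram k k * s.gradGram j l) / 2 * el

lemma dist_pos {i j : Fin 4} (h : i ≠ j) : 0 < dist (s.points i) (s.points j) :=
  _root_.dist_pos.2 (s.independent.injective.ne h)

lemma gradDet_pos : 0 < s.gradDet := by
  have h := s.dist_sq_mul_gradDet (i := 0) (j := 1) (k := 2) (l := 3) (by decide)
  have hm := s.gradMinor_pos (k := 2) (l := 3) (by decide)
  rw [← h] at hm
  exact pos_of_mul_pos_right hm (sq_nonneg _)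

lemma dist_eq {i j k l : Fin 4} (h : [i, j, k, l].Nodup) :
    dist (s.points i) (s.points j) = √(s.gradMinor k l) / √s.gradDet := by
  rw [← Real.sqrt_div' _ s.gradDet_pos.le, ← s.dist_sq_mul_gradDet h,
    mul_div_cancel_right₀ _ s.gradDet_pos.ne', Real.sqrt_sq dist_nonneg]

/-- The inner product of the gradients, inside the face opposite to `l`, of the barycentric
coordinates of two corners, in terms of the circumcenter of that face. -/
lemma dist_sq_mul_face_gradGram {i j k l : Fin 4} (h : [i, j, k, l].Nodup) :
    dist (s.points i) (s.points j) ^ 2 *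
      (s.gradGram i j - s.gradGram i l * s.gradGram j l / s.gradGram l l) =
      -2 * (s.centerCoord k - s.centerCoord l / s.gradGram l l * s.gradGram k l) := by
  have hE := fun p q => (sum_of_nodup h _).symm.trans (s.sum_dist_sq_mul_gradGram p q)
  have hM := (sum_of_nodup h _).symm.trans (s.sum_gradGram l)
  have hc := (sum_of_nodup h _).symm.trans s.sum_centerCoord
  have hll := (s.gradGram_self_pos l).ne'
  simp only [List.nodup_cons, List.mem_cons, List.not_mem_nil, or_false, not_or] at h
  obtain ⟨⟨hij, hik, hil⟩, ⟨hjk, hjl⟩, hkl, -⟩ := h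
  have eii := hE i i
  have ejj := hE j j
  have ekk := hE k k
  have eil := hE i l
  have ejl := hE j l
  have ekl := hE k l
  simp only [dist_self, dist_comm (s.points j) (s.points i), dist_comm (s.points k) (s.points i),
    dist_comm (s.points k) (s.points j), if_neg hil, if_neg hjl,
    if_neg hkl, if_true, s.gradGram_comm l, s.gradGram_comm j i, s.gradGram_comm k i,
    s.gradGram_comm k j] at eii ejj ekk eil ejl ekl
  field_simp
  -- The equations with `l` pass to the Schur complement, the Gram matrix of the face. There the
  -- diagonal equations `ii + jj - kk` isolate the entry `ij`, and the coordinates of the face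
  -- circumcenter sum to 1.
  linear_combination (s.gradGram l l * (eii + ejj - ekk) - s.gradGram i l * eil -
    s.gradGram j l * ejl + s.gradGram k l * ekl) / 2 + s.gradGram l l * hc -
    s.centerCoord l * hM

/-- Writing the minor as squared length times `gradDet` leaves a common denominator for all edges
and the edge coefficients of `sum_edges_laplacian_identity`. -/
lemma dualContribution_div_dist (a : Fin 6) :
    4 * (s.dualContribution a / dist (s.points (iv a)) (s.points (jv a))) =
      -(s.centerCoord (lv a) * (s.gradGram (iv a) (jv a) -
          s.gradGram (iv a) (lv a) * s.gradGram (jv a) (lv a) / s.gradGram (lv a) (lv a)) +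
        s.centerCoord (kv a) * (s.gradGram (iv a) (jv a) -
          s.gradGram (iv a) (kv a) * s.gradGram (jv a) (kv a) / s.gradGram (kv a) (kv a))) /
        √s.gradDet := by
  have h := nodup_corners a
  have h' := nodup_corners' a
  have e1 := s.dist_sq_mul_face_gradGram h
  have e2 := s.dist_sq_mul_face_gradGram h'
  have hd := s.dist_eq h
  have hpos : 0 < dist (s.points (iv a)) (s.points (jv a)) :=
    s.dist_pos (by clear * -; revert a; decide)
  have hm : √(s.gradMinor (kv a) (lv a)) =
      dist (s.points (iv a)) (s.points (jv a)) * √s.gradDet := by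
    rw [hd, div_mul_cancel₀ _ (Real.sqrt_ne_zero'.2 s.gradDet_pos)]
  have hD := Real.sqrt_ne_zero'.2 s.gradDet_pos
  rw [dualContribution_eq, hm]
  rw [s.gradGram_comm (lv a) (kv a)] at e2
  generalize dist (s.points (iv a)) (s.points (jv a)) = d at *
  generalize √s.gradDet = δ at *
  generalize s.gradGram (iv a) (jv a) - s.gradGram (iv a) (lv a) * _ / _ = x at *
  generalize s.gradGram (iv a) (jv a) - s.gradGram (iv a) (kv a) * _ / _ = y at *
  generalize s.centerCoord (kv a) - _ = z at *
  generalize s.centerCoord (lv a) - _ = w at *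
  have hpos' := hpos.ne'
  field_simp
  linear_combination 2 * s.centerCoord (lv a) * e1 + 2 * s.centerCoord (kv a) * e2

end Tetra

/-! ### Smooth dependence on the lengths and first variation of the Gram matrix -/

namespace Tetra

section Regularity

variable {F : Type*} [NormedAddCommGroup F] [NormedSpace ℝ F]

lemma _root_.Matrix.contDiffAt_det {ι : Type*} [Fintype ι] [DecidableEq ι] {n : WithTop ℕ∞}
    {A : F → Matrix ι ι ℝ} {x : F} (hA : ∀ i j, ContDiffAt ℝ n (fun y => A y i j) x) :
    ContDiffAt ℝ n (fun y => (A y).det) x := by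
  simp only [Matrix.det_apply]
  exact ContDiffAt.sum fun σ _ => (contDiffAt_prod fun i _ => hA _ _).const_smul _

lemma _root_.Matrix.contDiffAt_inv {ι : Type*} [Fintype ι] [DecidableEq ι] {n : WithTop ℕ∞}
    {A : F → Matrix ι ι ℝ} {x : F} (hA : ∀ i j, ContDiffAt ℝ n (fun y => A y i j) x)
    (hx : (A x).det ≠ 0) (i j : ι) : ContDiffAt ℝ n (fun y => (A y)⁻¹ i j) x := by
  simp only [Matrix.inv_def, Ring.inverse_eq_inv', Matrix.smul_apply, smul_eq_mul,
    Matrix.adjugate_apply]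
  refine ((Matrix.contDiffAt_det hA).inv hx).mul (Matrix.contDiffAt_det fun k l => ?_)
  by_cases h : k = j
  · subst h
    simp only [Matrix.updateRow_self]
    exact contDiffAt_const
  · simp only [Matrix.updateRow_ne h]
    exact hA k l

/-- The Cayley-Menger matrix: the matrix of squared distances, bordered by ones. -/
def cayleyMenger (s : Tetra) : Matrix (Option (Fin 4)) (Option (Fin 4)) ℝ :=
  Matrix.of fun i j => i.elim (j.elim 0 fun _ => 1) fun i =>
    j.elim 1 fun j => dist (s.points i) (s.points j) ^ 2

/-- The inverse of the Cayley-Menger matrix. -/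
def cayleyMengerInv (s : Tetra) : Matrix (Option (Fin 4)) (Option (Fin 4)) ℝ :=
  Matrix.of fun i j => i.elim
    (j.elim (-(2 * s.circumradius ^ 2)) s.centerCoord) fun i =>
    j.elim (s.centerCoord i) fun j => -(1 / 2) * s.gradGram i j

lemma cayleyMengerInv_mul (s : Tetra) : s.cayleyMengerInv * s.cayleyMenger = 1 := by
  ext i j
  rw [Matrix.mul_apply, Fintype.sum_option]
  cases i with
  | none =>
    cases j with
    | none => simp [cayleyMenger, cayleyMengerInv, sum_centerCoord]
    | some j =>
      simp only [cayleyMenger, cayleyMengerInv, Matrix.of_apply, Option.elim]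
      simp only [dist_comm _ (s.points j), mul_comm (s.centerCoord _),
        sum_dist_sq_mul_centerCoord]
      simp
  | some i =>
    cases j with
    | none =>
      simp [cayleyMenger, cayleyMengerInv, s.gradGram_comm i, ← Finset.mul_sum, sum_gradGram]
    | some j =>
      simp only [cayleyMenger, cayleyMengerInv, Matrix.of_apply, Option.elim]
      simp only [dist_comm _ (s.points j), mul_assoc, mul_comm (s.gradGram _ _),
        s.gradGram_comm i, ← Finset.mul_sum, sum_dist_sq_mul_gradGram, Matrix.one_apply,
        Option.some_inj, eq_comm (a := j)]
      split_ifs <;> ring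

/-- Only the squared distances are assumed smooth. The family `S` itself may jump by isometries, as
arbitrarily chosen realizations do. -/
lemma contDiffAt_cayleyMengerInv {n : WithTop ℕ∞} {S : F → Tetra} {x : F}
    (hS : ∀ i j : Fin 4, ContDiffAt ℝ n (fun y => dist ((S y).points i) ((S y).points j) ^ 2) x)
    (i j : Option (Fin 4)) : ContDiffAt ℝ n (fun y => (S y).cayleyMengerInv i j) x := by
  simp only [← fun y => Matrix.inv_eq_left_inv (cayleyMengerInv_mul (S y))]
  refine Matrix.contDiffAt_inv (fun i j => ?_) ?_ i j
  · cases i <;> cases j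
    · exact contDiffAt_const
    · exact contDiffAt_const
    · exact contDiffAt_const
    · exact hS _ _
  · intro h
    have := congrArg Matrix.det (cayleyMengerInv_mul (S x))
    simp [h] at this

lemma contDiffAt_gradGram {n : WithTop ℕ∞} {S : F → Tetra} {x : F}
    (hS : ∀ i j : Fin 4, ContDiffAt ℝ n (fun y => dist ((S y).points i) ((S y).points j) ^ 2) x)
    (i j : Fin 4) : ContDiffAt ℝ n (fun y => (S y).gradGram i j) x := by
  have h := (contDiffAt_cayleyMengerInv hS (some i) (some j)).const_smul (-2 : ℝ)
  refine h.congr_of_eventuallyEq (Filter.Eventually.of_forall fun y => ?_)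
  simp [cayleyMengerInv]

lemma contDiffAt_centerCoord {n : WithTop ℕ∞} {S : F → Tetra} {x : F}
    (hS : ∀ i j : Fin 4, ContDiffAt ℝ n (fun y => dist ((S y).points i) ((S y).points j) ^ 2) x)
    (i : Fin 4) : ContDiffAt ℝ n (fun y => (S y).centerCoord i) x :=
  contDiffAt_cayleyMengerInv hS none (some i)

/-- Keeps the argument of `arccos` away from ±1, where it is not differentiable. -/
lemma abs_gradGram_div_lt_one (s : Tetra) {k l : Fin 4} (h : k ≠ l) :
    |-s.gradGram k l / √(s.gradGram k k * s.gradGram l l)| < 1 := by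
  have hp := mul_pos (s.gradGram_self_pos k) (s.gradGram_self_pos l)
  have hm := s.gradGram_minor_pos h
  rw [← sq_lt_one_iff_abs_lt_one, div_pow, Real.sq_sqrt hp.le, div_lt_one hp]
  linarith [neg_sq (s.gradGram k l)]

lemma kv_ne_lv (a : Fin 6) : kv a ≠ lv a := by revert a; decide

lemma contDiffAt_dihedral {n : WithTop ℕ∞} {S : F → Tetra} {x : F}
    (hS : ∀ i j : Fin 4, ContDiffAt ℝ n (fun y => dist ((S y).points i) ((S y).points j) ^ 2) x)
    (a : Fin 6) : ContDiffAt ℝ n (fun y => (S y).dihedral a) x := by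
  have hM := contDiffAt_gradGram hS
  have hp := mul_pos ((S x).gradGram_self_pos (kv a)) ((S x).gradGram_self_pos (lv a))
  have h1 := abs_lt.1 ((S x).abs_gradGram_div_lt_one (kv_ne_lv a))
  simp only [dihedral_eq]
  exact ContDiffAt.comp (g := Real.arccos) x (Real.contDiffAt_arccos h1.1.ne' h1.2.ne)
    ((hM (kv a) (lv a)).neg.div (((hM _ _).mul (hM _ _)).sqrt hp.ne') (Real.sqrt_ne_zero'.2 hp))

end Regularity

section Variation

/-- The derivative of a dihedral angle in terms of a variation `M'` of the matrix `gradGram`. -/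
lemma hasDerivAt_dihedral {S : ℝ → Tetra} {M' : Fin 4 → Fin 4 → ℝ}
    (hM : ∀ i j, HasDerivAt (fun t => (S t).gradGram i j) (M' i j) 0) (a : Fin 6) :
    HasDerivAt (fun t => (S t).dihedral a)
      ((M' (kv a) (lv a) - 1 / 2 * (S 0).gradGram (kv a) (lv a) *
        (M' (kv a) (kv a) / (S 0).gradGram (kv a) (kv a) +
          M' (lv a) (lv a) / (S 0).gradGram (lv a) (lv a))) /
        √((S 0).gradMinor (kv a) (lv a))) 0 := by
  have hk := (S 0).gradGram_self_pos (kv a)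
  have hl := (S 0).gradGram_self_pos (lv a)
  have hp := mul_pos hk hl
  have hm := (S 0).gradMinor_pos (kv_ne_lv a)
  have h1 := abs_lt.1 ((S 0).abs_gradGram_div_lt_one (kv_ne_lv a))
  have hs := Real.sqrt_pos.2 hp
  simp only [dihedral_eq]
  have hd := (Real.hasDerivAt_arccos h1.1.ne' h1.2.ne).comp 0
    ((hM (kv a) (lv a)).neg.div (((hM (kv a) (kv a)).mul (hM (lv a) (lv a))).sqrt hp.ne') hs.ne')
  refine hd.congr_deriv ?_
  -- This is the squared sine of the dihedral angle.
  have hq : 1 - (-(S 0).gradGram (kv a) (lv a) /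
      √((S 0).gradGram (kv a) (kv a) * (S 0).gradGram (lv a) (lv a))) ^ 2 =
      (S 0).gradMinor (kv a) (lv a) /
        ((S 0).gradGram (kv a) (kv a) * (S 0).gradGram (lv a) (lv a)) := by
    rw [div_pow, Real.sq_sqrt hp.le, gradMinor]
    field_simp
  have hs2 := Real.sq_sqrt hp.le
  simp only [Pi.neg_apply, Pi.mul_apply]
  rw [hq, Real.sqrt_div hm.le, hs2]
  have hms := Real.sqrt_pos.2 hm
  generalize √((S 0).gradMinor (kv a) (lv a)) = δ at *
  generalize √((S 0).gradGram (kv a) (kv a) * (S 0).gradGram (lv a) (lv a)) = r at *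
  field_simp
  linear_combination 2 * M' (kv a) (lv a) * hs2

/-- Differentiating the bordered inverse identity gives a linear system for the variation. It has a
closed solution because the variation of the squared distances is the distance matrix multiplied by
`φ` on either side. -/
lemma hasDerivAt_gradGram {S : ℝ → Tetra} {φ : Fin 4 → ℝ}
    (hS : ∀ i j : Fin 4, ContDiffAt ℝ 1 (fun t => dist ((S t).points i) ((S t).points j) ^ 2) 0)
    (hφ : ∀ i j : Fin 4, HasDerivAt (fun t => dist ((S t).points i) ((S t).points j) ^ 2)
      (dist ((S 0).points i) ((S 0).points j) ^ 2 * (φ i + φ j)) 0) (i j : Fin 4) :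
    HasDerivAt (fun t => (S t).gradGram i j)
      (∑ k, φ k * ((S 0).gradGram k i * (S 0).centerCoord j +
        (S 0).gradGram k j * (S 0).centerCoord i) -
        (φ i + φ j) * (S 0).gradGram i j) 0 := by
  have hM := fun i j =>
    ((contDiffAt_gradGram hS i j).differentiableAt one_ne_zero).hasDerivAt
  have hc := fun i =>
    ((contDiffAt_centerCoord hS i).differentiableAt one_ne_zero).hasDerivAt
  refine (hM i j).congr_deriv ?_
  generalize hM' : (fun i j => deriv (fun t => (S t).gradGram i j) 0) = M' at hM
  generalize hc' : (fun i => deriv (fun t => (S t).centerCoord i) 0) = c' at hc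
  have hM := fun i j => (hM i j).congr_deriv (congrFun₂ hM' i j)
  have hc := fun i => (hc i).congr_deriv (congrFun hc' i)
  rw [congrFun₂ hM' i j]
  have hsum : ∑ k, M' k j = 0 := by
    have h1 := HasDerivAt.fun_sum fun k (_ : k ∈ Finset.univ) => hM k j
    simp only [sum_gradGram] at h1
    exact h1.unique (hasDerivAt_const _ _)
  have hmul : ∀ p : Fin 4, ∑ k : Fin 4,
      (dist ((S 0).points p) ((S 0).points k) ^ 2 * (φ p + φ k) * (S 0).gradGram k j +
        dist ((S 0).points p) ((S 0).points k) ^ 2 * M' k j) = 2 * c' j := by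
    intro p
    have h1 := HasDerivAt.fun_sum fun k (_ : k ∈ Finset.univ) => (hφ p k).fun_mul (hM k j)
    simp only [sum_dist_sq_mul_gradGram] at h1
    exact h1.unique (((hc j).const_mul 2).sub_const _)
  have hcol : ∀ k : Fin 4,
      ∑ p : Fin 4, dist ((S 0).points p) ((S 0).points k) ^ 2 * (S 0).gradGram p i =
        2 * (S 0).centerCoord i - (if k = i then 2 else 0) := fun k => by
    simp only [dist_comm _ ((S 0).points k), sum_dist_sq_mul_gradGram]
  -- Contracting with column `i` of `gradGram` kills the unknown `c'`, since that column sums to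
  -- zero, and isolates `M' i j`.
  have htot : ∑ p : Fin 4, (S 0).gradGram p i * (∑ k : Fin 4,
      (dist ((S 0).points p) ((S 0).points k) ^ 2 * (φ p + φ k) * (S 0).gradGram k j +
        dist ((S 0).points p) ((S 0).points k) ^ 2 * M' k j)) =
      ∑ p : Fin 4, φ p * (S 0).gradGram p i *
        (∑ k : Fin 4, dist ((S 0).points p) ((S 0).points k) ^ 2 * (S 0).gradGram k j) +
      ∑ k : Fin 4, (φ k * (S 0).gradGram k j + M' k j) *
        (∑ p : Fin 4, dist ((S 0).points p) ((S 0).points k) ^ 2 * (S 0).gradGram p i) := by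
    simp only [Fin.sum_univ_four]
    ring
  simp only [hmul, hcol, sum_dist_sq_mul_gradGram, ← Finset.sum_mul, sum_gradGram, mul_sub,
    Finset.sum_sub_distrib, add_mul, Finset.sum_add_distrib, hsum, mul_ite, mul_zero,
    Finset.sum_ite_eq', Finset.mem_univ, if_true] at htot
  simp only [mul_add, Finset.sum_add_distrib, ← mul_assoc, ← Finset.sum_mul]
  rw [(S 0).gradGram_comm j i] at htot
  linear_combination htot / 2

end Variation

end Tetra

/-! ### Conformal variation of the dihedral angles of one tetrahedron -/

namespace Tetra

lemma sum_edges_eq (F : Fin 4 → Fin 4 → Fin 4 → Fin 4 → ℝ) :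
    ∑ a, F (iv a) (jv a) (kv a) (lv a) = F 0 1 2 3 + F 0 2 1 3 + F 0 3 1 2 + F 1 2 0 3 +
      F 1 3 0 2 + F 2 3 0 1 := by
  rw [Fin.sum_univ_six]
  rfl

/-- Summing the variations of the dihedral angles over the edges at a corner leaves only the
variation of the diagonal entries of the Gram matrix. -/
lemma sum_edges_gram_variation {M M' : Fin 4 → Fin 4 → ℝ} (x ψ : Fin 4 → ℝ)
    (hM : ∀ i j, M i j = M j i) (hM' : ∀ i j, M' i j = M' j i) (hs : ∀ j, ∑ i, M i j = 0)
    (hs' : ∀ j, ∑ i, M' i j = 0) (hx : ∀ i, x i * M i i = M' i i) :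
    ∑ a, (M' (kv a) (lv a) - 1 / 2 * M (kv a) (lv a) * (x (kv a) + x (lv a))) *
      (ψ (iv a) + ψ (jv a)) = 1 / 2 * ∑ p, ψ p * ∑ i, M p i * x i := by
  have h : ∀ j, M 0 j + M 1 j + M 2 j + M 3 j = 0 := fun j => by
    rw [← hs j, Fin.sum_univ_four]
  have h' : ∀ j, M' 0 j + M' 1 j + M' 2 j + M' 3 j = 0 := fun j => by
    rw [← hs' j, Fin.sum_univ_four]
  have x0 := hx 0
  have x1 := hx 1
  have x2 := hx 2
  have x3 := hx 3
  -- The weight of a term is the total of `ψ` minus `ψ k + ψ l`. By the zero column sums the `M'`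
  -- part depends only on the diagonal of `M'`, and it cancels against the diagonal part of the `M`
  -- terms through `x i * M i i = M' i i`.
  rw [sum_edges_eq fun i j k l => (M' k l - 1 / 2 * M k l * (x k + x l)) * (ψ i + ψ j)]
  simp only [Fin.sum_univ_four]
  have d0 : M 0 0 = -(M 0 1 + M 0 2 + M 0 3) := by linarith [h 0, hM 0 1, hM 0 2, hM 0 3]
  have d1 : M 1 1 = -(M 0 1 + M 1 2 + M 1 3) := by linarith [h 1, hM 1 2, hM 1 3]
  have d2 : M 2 2 = -(M 0 2 + M 1 2 + M 2 3) := by linarith [h 2, hM 2 3]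
  have d3 : M 3 3 = -(M 0 3 + M 1 3 + M 2 3) := by linarith [h 3]
  have d0' : M' 0 0 = -(M' 0 1 + M' 0 2 + M' 0 3) := by linarith [h' 0, hM' 0 1, hM' 0 2, hM' 0 3]
  have d1' : M' 1 1 = -(M' 0 1 + M' 1 2 + M' 1 3) := by linarith [h' 1, hM' 1 2, hM' 1 3]
  have d2' : M' 2 2 = -(M' 0 2 + M' 1 2 + M' 2 3) := by linarith [h' 2, hM' 2 3]
  have d3' : M' 3 3 = -(M' 0 3 + M' 1 3 + M' 2 3) := by linarith [h' 3]
  rw [d0, d0'] at x0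
  rw [d1, d1'] at x1
  rw [d2, d2'] at x2
  rw [d3, d3'] at x3
  rw [d0, d1, d2, d3, hM 1 0, hM 2 0, hM 3 0, hM 2 1, hM 3 1, hM 3 2]
  linear_combination 1 / 2 * ((ψ 1 + ψ 2 + ψ 3 - ψ 0) * x0 + (ψ 0 + ψ 2 + ψ 3 - ψ 1) * x1 +
    (ψ 0 + ψ 1 + ψ 3 - ψ 2) * x2 + (ψ 0 + ψ 1 + ψ 2 - ψ 3) * x3)

/-- For a symmetric `A` with zero row sums, `∑ ψ p * A p q * φ q` is minus the sum over pairs of `A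
i j * (ψ i - ψ j) * (φ i - φ j)`. Apply this to `M` and to the rank-one matrices `M p m * M q m`. On
pairs containing `m`, the factor `r m` reduces the latter to `M`, and the weight `1 - c i - c j`
becomes `c k + c l`. -/
lemma sum_edges_laplacian_identity {M : Fin 4 → Fin 4 → ℝ} (c r φ ψ : Fin 4 → ℝ)
    (hM : ∀ i j, M i j = M j i) (hs : ∀ j, ∑ i, M i j = 0) (hc : ∑ i, c i = 1)
    (hr : ∀ i, r i * M i i = 1) :
    ∑ p, ψ p * ∑ i, M p i * ((∑ k, φ k * M k i) * c i * r i - φ i) =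
    ∑ a, (c (lv a) * (M (iv a) (jv a) - M (iv a) (lv a) * M (jv a) (lv a) * r (lv a)) +
      c (kv a) * (M (iv a) (jv a) - M (iv a) (kv a) * M (jv a) (kv a) * r (kv a))) *
      ((ψ (iv a) - ψ (jv a)) * (φ (iv a) - φ (jv a))) := by
  have h : ∀ j, M 0 j + M 1 j + M 2 j + M 3 j = 0 := fun j => by
    rw [← hs j, Fin.sum_univ_four]
  have r0 := hr 0
  have r1 := hr 1
  have r2 := hr 2
  have r3 := hr 3
  rw [sum_edges_eq fun i j k l => (c l * (M i j - M i l * M j l * r l) +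
    c k * (M i j - M i k * M j k * r k)) * ((ψ i - ψ j) * (φ i - φ j))]
  simp only [Fin.sum_univ_four] at hc ⊢
  have d0 : M 0 0 = -(M 0 1 + M 0 2 + M 0 3) := by linarith [h 0, hM 0 1, hM 0 2, hM 0 3]
  have d1 : M 1 1 = -(M 0 1 + M 1 2 + M 1 3) := by linarith [h 1, hM 1 2, hM 1 3]
  have d2 : M 2 2 = -(M 0 2 + M 1 2 + M 2 3) := by linarith [h 2, hM 2 3]
  have d3 : M 3 3 = -(M 0 3 + M 1 3 + M 2 3) := by linarith [h 3]
  rw [d0] at r0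
  rw [d1] at r1
  rw [d2] at r2
  rw [d3] at r3
  rw [d0, d1, d2, d3, hM 1 0, hM 2 0, hM 3 0, hM 2 1, hM 3 1, hM 3 2]
  linear_combination
    -(c 0 * (M 0 1 * (ψ 0 - ψ 1) * (φ 0 - φ 1) + M 0 2 * (ψ 0 - ψ 2) * (φ 0 - φ 2) +
      M 0 3 * (ψ 0 - ψ 3) * (φ 0 - φ 3))) * r0
    -(c 1 * (M 0 1 * (ψ 0 - ψ 1) * (φ 0 - φ 1) + M 1 2 * (ψ 1 - ψ 2) * (φ 1 - φ 2) +
      M 1 3 * (ψ 1 - ψ 3) * (φ 1 - φ 3))) * r1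
    -(c 2 * (M 0 2 * (ψ 0 - ψ 2) * (φ 0 - φ 2) + M 1 2 * (ψ 1 - ψ 2) * (φ 1 - φ 2) +
      M 2 3 * (ψ 2 - ψ 3) * (φ 2 - φ 3))) * r2
    -(c 3 * (M 0 3 * (ψ 0 - ψ 3) * (φ 0 - φ 3) + M 1 3 * (ψ 1 - ψ 3) * (φ 1 - φ 3) +
      M 2 3 * (ψ 2 - ψ 3) * (φ 2 - φ 3))) * r3
    - (M 0 1 * (ψ 0 - ψ 1) * (φ 0 - φ 1) + M 0 2 * (ψ 0 - ψ 2) * (φ 0 - φ 2) +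
      M 0 3 * (ψ 0 - ψ 3) * (φ 0 - φ 3) + M 1 2 * (ψ 1 - ψ 2) * (φ 1 - φ 2) +
      M 1 3 * (ψ 1 - ψ 3) * (φ 1 - φ 3) + M 2 3 * (ψ 2 - ψ 3) * (φ 2 - φ 3)) * hc

/-- The variation of the dihedral angles under a conformal change of the edge lengths. For constant
`ψ` this is the Schläfli formula. -/
theorem exists_hasDerivAt_dihedral {S : ℝ → Tetra} {φ : Fin 4 → ℝ}
    (hS : ∀ i j : Fin 4, ContDiffAt ℝ 1 (fun t => dist ((S t).points i) ((S t).points j) ^ 2) 0)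
    (hφ : ∀ i j : Fin 4, HasDerivAt (fun t => dist ((S t).points i) ((S t).points j) ^ 2)
      (dist ((S 0).points i) ((S 0).points j) ^ 2 * (φ i + φ j)) 0) :
    ∃ θ : Fin 6 → ℝ, (∀ a, HasDerivAt (fun t => (S t).dihedral a) (θ a) 0) ∧
      ∀ ψ : Fin 4 → ℝ,
        ∑ a, dist ((S 0).points (iv a)) ((S 0).points (jv a)) * θ a * (ψ (iv a) + ψ (jv a)) =
        -4 * ∑ a, (S 0).dualContribution a / dist ((S 0).points (iv a)) ((S 0).points (jv a)) *
          ((ψ (iv a) - ψ (jv a)) * (φ (iv a) - φ (jv a))) := by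
  have hM := hasDerivAt_gradGram hS hφ
  refine ⟨_, fun a => hasDerivAt_dihedral hM a, fun ψ => ?_⟩
  obtain ⟨M', hMe⟩ : ∃ M' : Fin 4 → Fin 4 → ℝ, ∀ i j,
      ∑ k, φ k * ((S 0).gradGram k i * (S 0).centerCoord j +
        (S 0).gradGram k j * (S 0).centerCoord i) -
        (φ i + φ j) * (S 0).gradGram i j = M' i j := ⟨_, fun _ _ => rfl⟩
  simp only [hMe] at hM ⊢
  have hM's : ∀ i j, M' i j = M' j i := fun i j => (hM i j).unique (by
    simpa only [gradGram_comm _ i j] using hM j i)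
  have hs' : ∀ j, ∑ i, M' i j = 0 := fun j => by
    have h1 := HasDerivAt.fun_sum fun k (_ : k ∈ Finset.univ) => hM k j
    simp only [sum_gradGram] at h1
    exact h1.unique (hasDerivAt_const _ _)
  have h0 := fun i => ((S 0).gradGram_self_pos i).ne'
  have hA := sum_edges_gram_variation (fun i => M' i i / (S 0).gradGram i i) ψ
    (S 0).gradGram_comm hM's (S 0).sum_gradGram hs' fun i => div_mul_cancel₀ _ (h0 i)
  have hB := sum_edges_laplacian_identity (S 0).centerCoord (fun i => ((S 0).gradGram i i)⁻¹) φ ψ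
    (S 0).gradGram_comm (S 0).sum_gradGram (S 0).sum_centerCoord fun i => inv_mul_cancel₀ (h0 i)
  have hx : ∀ i, M' i i / (S 0).gradGram i i = 2 * ((∑ k, φ k * (S 0).gradGram k i) *
      (S 0).centerCoord i * ((S 0).gradGram i i)⁻¹ - φ i) := fun i => by
    rw [← hMe i i]
    have h1 : ∑ k, φ k * ((S 0).gradGram k i * (S 0).centerCoord i +
        (S 0).gradGram k i * (S 0).centerCoord i) =
        2 * ((∑ k, φ k * (S 0).gradGram k i) * (S 0).centerCoord i) := by
      rw [Finset.sum_mul, Finset.mul_sum]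
      exact Finset.sum_congr rfl fun k _ => by ring
    have := h0 i
    rw [h1]
    field_simp
    ring
  -- The edge length is proportional to the square root of the minor, which is the denominator of
  -- the angle variation. After cancellation the factor no longer depends on the edge.
  have hl : ∀ a, dist ((S 0).points (iv a)) ((S 0).points (jv a)) * ((M' (kv a) (lv a) -
      1 / 2 * (S 0).gradGram (kv a) (lv a) * (M' (kv a) (kv a) / (S 0).gradGram (kv a) (kv a) +
        M' (lv a) (lv a) / (S 0).gradGram (lv a) (lv a))) / √((S 0).gradMinor (kv a) (lv a))) *
        (ψ (iv a) + ψ (jv a)) = (√(S 0).gradDet)⁻¹ * ((M' (kv a) (lv a) -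
      1 / 2 * (S 0).gradGram (kv a) (lv a) * (M' (kv a) (kv a) / (S 0).gradGram (kv a) (kv a) +
        M' (lv a) (lv a) / (S 0).gradGram (lv a) (lv a))) * (ψ (iv a) + ψ (jv a))) := fun a => by
    rw [(S 0).dist_eq (nodup_corners a)]
    have := Real.sqrt_ne_zero'.2 ((S 0).gradMinor_pos (kv_ne_lv a))
    field_simp
  rw [Finset.mul_sum, Finset.sum_congr rfl fun a _ => hl a, ← Finset.mul_sum, hA]
  simp only [hx, mul_left_comm _ (2 : ℝ), ← Finset.mul_sum]
  have hhalf : ∀ x y : ℝ, 2 * (x * (1 / 2 * y)) = x * y := fun x y => by ring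
  rw [hB, hhalf, Finset.mul_sum, Finset.mul_sum]
  refine Finset.sum_congr rfl fun a _ => ?_
  have := (S 0).dualContribution_div_dist a
  simp only [div_eq_mul_inv] at this ⊢
  linear_combination
    ((ψ (iv a) - ψ (jv a)) * (φ (iv a) - φ (jv a))) * this

end Tetra

/-! ### Openness of the set of realizable edge lengths -/

open scoped MatrixOrder in
lemma Matrix.PosDef.exists_gram_eq {n : ℕ} {A : Matrix (Fin n) (Fin n) ℝ} (hA : A.PosDef) :
    ∃ u : Fin n → EuclideanSpace ℝ (Fin n), Matrix.gram ℝ u = A ∧ LinearIndependent ℝ u := by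
  obtain ⟨B, hB⟩ := CStarAlgebra.nonneg_iff_eq_star_mul_self.mp hA.posSemidef.nonneg
  have hg : Matrix.gram ℝ (fun i => WithLp.toLp 2 fun k => B k i) = A := by
    ext i j
    simp [hB, Matrix.gram_apply, Matrix.mul_apply, PiLp.inner_apply,
      Matrix.star_eq_conjTranspose, mul_comm]
  exact ⟨_, hg, Matrix.linearIndependent_of_posDef_gram (hg ▸ hA)⟩

/-- Positivity of the quadratic form is tested on the compact unit sphere and extended by
homogeneity. Symmetry is a closed condition and is therefore assumed of `B` separately. -/
lemma Matrix.PosDef.eventually_posDef {ι : Type*} [Fintype ι] {A : Matrix ι ι ℝ}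
    (hA : A.PosDef) : ∀ᶠ B in 𝓝 A, B.IsHermitian → B.PosDef := by
  have hc : Continuous fun z : Matrix ι ι ℝ × (ι → ℝ) => z.2 ⬝ᵥ z.1.mulVec z.2 :=
    continuous_snd.dotProduct (continuous_fst.matrix_mulVec continuous_snd)
  have h := (isCompact_sphere (0 : ι → ℝ) 1).eventually_forall_of_forall_eventually
    (x₀ := A) (P := fun B v => 0 < v ⬝ᵥ B.mulVec v) fun v hv => by
      have hv0 : v ≠ 0 := ne_zero_of_mem_unit_sphere ⟨v, hv⟩
      exact hc.continuousAt.eventually_const_lt (by simpa using hA.dotProduct_mulVec_pos hv0)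
  filter_upwards [h] with B hB hBh
  refine .of_dotProduct_mulVec_pos hBh fun v hv => ?_
  have hv' : 0 < ‖v‖ := norm_pos_iff.2 hv
  have h1 := hB (‖v‖⁻¹ • v) (by simp [norm_smul, hv'.ne'])
  rw [Matrix.mulVec_smul, smul_dotProduct, dotProduct_smul, smul_eq_mul, smul_eq_mul,
    ← mul_assoc] at h1
  simpa using pos_of_mul_pos_right h1 (mul_self_nonneg _)

namespace Tetra

/-- The Gram matrix of the edge vectors at the corner `0`, in terms of the edge lengths. -/
def lengthGram (d : Fin 6 → ℝ) : Matrix (Fin 3) (Fin 3) ℝ :=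
  !![d 0 ^ 2, (d 0 ^ 2 + d 1 ^ 2 - d 3 ^ 2) / 2, (d 0 ^ 2 + d 2 ^ 2 - d 4 ^ 2) / 2;
    (d 0 ^ 2 + d 1 ^ 2 - d 3 ^ 2) / 2, d 1 ^ 2, (d 1 ^ 2 + d 2 ^ 2 - d 5 ^ 2) / 2;
    (d 0 ^ 2 + d 2 ^ 2 - d 4 ^ 2) / 2, (d 1 ^ 2 + d 2 ^ 2 - d 5 ^ 2) / 2, d 2 ^ 2]

lemma lengthGram_isHermitian (d : Fin 6 → ℝ) : (lengthGram d).IsHermitian := by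
  ext i j
  fin_cases i <;> fin_cases j <;> rfl

lemma continuous_lengthGram : Continuous lengthGram := by
  refine continuous_matrix fun i j => ?_
  fin_cases i <;> fin_cases j <;> simp [lengthGram] <;> fun_prop

/-- The lengths of the six edges. -/
def edgeLengths (s : Tetra) (a : Fin 6) : ℝ := dist (s.points (iv a)) (s.points (jv a))

lemma inner_sub_sub_eq (p q r : E3) :
    inner ℝ (q - p) (r - p) = (dist p q ^ 2 + dist p r ^ 2 - dist q r ^ 2) / 2 := by
  rw [dist_comm p q, dist_comm p r, dist_eq_norm, dist_eq_norm, dist_eq_norm,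
    ← sub_sub_sub_cancel_right q r p, norm_sub_sq_real (q - p)]
  ring

lemma lengthGram_edgeLengths (s : Tetra) : lengthGram s.edgeLengths =
    Matrix.gram ℝ fun i : Fin 3 => s.points i.succ - s.points 0 := by
  ext i j
  rw [Matrix.gram_apply, inner_sub_sub_eq]
  fin_cases i <;> fin_cases j <;> simp [lengthGram, edgeLengths, iv, jv,
    dist_comm (s.points 2) (s.points 1),
    dist_comm (s.points 3) (s.points 1), dist_comm (s.points 3) (s.points 2)] <;> ring

lemma posDef_lengthGram (s : Tetra) : (lengthGram s.edgeLengths).PosDef := by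
  rw [lengthGram_edgeLengths]
  have h := (affineIndependent_iff_linearIndependent_vsub ℝ s.points 0).1 s.independent
  refine Matrix.posDef_gram_of_linearIndependent ?_
  exact h.comp (fun i : Fin 3 => (⟨i.succ, Fin.succ_ne_zero i⟩ : {x : Fin 4 // x ≠ 0}))
    fun i j hij => Fin.succ_injective _ (congrArg Subtype.val hij)

lemma exists_edgeLengths_eq {d : Fin 6 → ℝ} (hd : ∀ a, 0 < d a) (h : (lengthGram d).PosDef) :
    ∃ s : Tetra, s.edgeLengths = d := by
  obtain ⟨u, hu, hli⟩ := h.exists_gram_eq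
  have hind : AffineIndependent ℝ (![0, u 0, u 1, u 2] : Fin 4 → E3) := by
    rw [affineIndependent_iff_linearIndependent_vsub ℝ _ 0]
    refine (linearIndependent_equiv (finSuccAboveEquiv (0 : Fin 4))).1 ?_
    have key : (fun i : {x : Fin 4 // x ≠ 0} => (![0, u 0, u 1, u 2] : Fin 4 → E3) i -ᵥ
        (![0, u 0, u 1, u 2] : Fin 4 → E3) 0) ∘ finSuccAboveEquiv (0 : Fin 4) = u := by
      funext i
      fin_cases i <;> simp [finSuccAboveEquiv_apply]
    rw [key]
    exact hli
  refine ⟨⟨_, hind⟩, funext fun a => ?_⟩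
  -- `lengthGram` sees only squares, so the sign of the lengths comes from `hd`.
  rw [← abs_of_pos (hd a), edgeLengths, ← abs_of_nonneg dist_nonneg, ← sq_eq_sq_iff_abs_eq_abs,
    dist_eq_norm, norm_sub_sq_real]
  have hu' : ∀ i j, inner ℝ (u i) (u j) = lengthGram d i j := congrFun₂ hu
  have hn : ∀ i, ‖u i‖ ^ 2 = lengthGram d i i := fun i => by
    rw [← real_inner_self_eq_norm_sq, hu']
  fin_cases a <;> simp [iv, jv, hn, hu', lengthGram] <;> ring

/-- Edge lengths near those of a nondegenerate tetrahedron are again realized by one. -/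
lemma eventually_exists_edgeLengths_eq (s : Tetra) :
    ∀ᶠ d in 𝓝 s.edgeLengths, ∃ s' : Tetra, s'.edgeLengths = d := by
  have h1 := continuous_lengthGram.continuousAt.eventually s.posDef_lengthGram.eventually_posDef
  have h2 : ∀ᶠ d in 𝓝 s.edgeLengths, ∀ a, 0 < d a :=
    Filter.eventually_all.2 fun a => (continuous_apply a).continuousAt.eventually_const_lt
      (s.dist_pos (by revert a; decide))
  filter_upwards [h1, h2] with d h1 h2
  exact exists_edgeLengths_eq h2 (h1 (lengthGram_isHermitian d))

end Tetra

/-! ### Functions on the vertices paired along edges; conformal metrics -/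

namespace Triangulation3

variable {V E T : Type*} (𝒯 : Triangulation3 V E T)

/-- The sum of the values of a function at the two endpoints of an edge. -/
def endSum (h : V → ℝ) (e : E) : ℝ :=
  Sym2.lift ⟨fun v w => h v + h w, fun _ _ => add_comm _ _⟩ (𝒯.ends e)

/-- The product of the differences of two functions along an edge. -/
def endDiffMul (h k : V → ℝ) (e : E) : ℝ :=
  Sym2.lift ⟨fun v w => (h v - h w) * (k v - k w), fun _ _ => by ring⟩ (𝒯.ends e)

lemma exists_ends_eq (e : E) : ∃ v w, v ≠ w ∧ 𝒯.ends e = s(v, w) := by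
  have h := 𝒯.ends_ne e
  induction hz : 𝒯.ends e using Sym2.ind with
  | _ v w => exact ⟨v, w, by rwa [hz, Sym2.mk_isDiag_iff] at h, rfl⟩

lemma endSum_edge (h : V → ℝ) (t : T) (a : Fin 6) : 𝒯.endSum h (𝒯.edge t a) =
    h (𝒯.vert t (Tetra.iv a)) + h (𝒯.vert t (Tetra.jv a)) := by
  rw [endSum, 𝒯.ends_edge, Sym2.lift_mk]

lemma endDiffMul_edge (h k : V → ℝ) (t : T) (a : Fin 6) : 𝒯.endDiffMul h k (𝒯.edge t a) =
    (h (𝒯.vert t (Tetra.iv a)) - h (𝒯.vert t (Tetra.jv a))) *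
      (k (𝒯.vert t (Tetra.iv a)) - k (𝒯.vert t (Tetra.jv a))) := by
  rw [endDiffMul, 𝒯.ends_edge, Sym2.lift_mk]

lemma endSum_add_smul (g h : V → ℝ) (r : ℝ) (e : E) :
    𝒯.endSum (g + r • h) e = 𝒯.endSum g e + r * 𝒯.endSum h e := by
  obtain ⟨v, w, -, hz⟩ := 𝒯.exists_ends_eq e
  simp only [endSum, hz, Sym2.lift_mk, Pi.add_apply, Pi.smul_apply, smul_eq_mul]
  ring

lemma endSum_one (e : E) : 𝒯.endSum (fun _ => 1) e = 2 := by
  obtain ⟨v, w, -, hz⟩ := 𝒯.exists_ends_eq e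
  simp only [endSum, hz, Sym2.lift_mk]
  norm_num

lemma endDiffMul_one (h : V → ℝ) (e : E) : 𝒯.endDiffMul (fun _ => 1) h e = 0 := by
  obtain ⟨v, w, -, hz⟩ := 𝒯.exists_ends_eq e
  simp only [endDiffMul, hz, Sym2.lift_mk, sub_self, zero_mul]

section Single

variable [DecidableEq V]

/-- Turns sums over the edges at `v` into weighted sums over all edges. Distinct endpoints are
essential: a loop would give 2. -/
lemma endSum_single (v : V) (e : E) :
    𝒯.endSum (Pi.single v 1) e = if v ∈ 𝒯.ends e then 1 else 0 := by
  obtain ⟨x, y, hxy, hz⟩ := 𝒯.exists_ends_eq e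
  simp only [endSum, hz, Sym2.lift_mk, Sym2.mem_iff, Pi.single_apply, eq_comm (a := v)]
  by_cases hx : x = v <;> by_cases hy : y = v <;> simp_all

lemma endSum_single_mul_single (v w : V) (e : E) :
    𝒯.endSum (Pi.single v 1) e * 𝒯.endSum (Pi.single w 1) e =
      if v = w then (if v ∈ 𝒯.ends e then 1 else 0) else
        if 𝒯.ends e = s(v, w) then 1 else 0 := by
  split_ifs with h h1 h2
  · subst h
    simp [endSum_single, h1]
  · simp [endSum_single, h1]
  · simp [endSum_single, h2]
  · rw [← (Sym2.mem_and_mem_iff h).not] at h2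
    simp only [endSum_single]
    split_ifs <;> simp_all

lemma endDiffMul_single (v w : V) (e : E) :
    𝒯.endDiffMul (Pi.single v 1) (Pi.single w 1) e =
      if v = w then (if v ∈ 𝒯.ends e then 1 else 0) else
        -if 𝒯.ends e = s(v, w) then 1 else 0 := by
  obtain ⟨x, y, hxy, hz⟩ := 𝒯.exists_ends_eq e
  simp only [endDiffMul, hz, Sym2.lift_mk, Sym2.mem_iff, Sym2.eq_iff, Pi.single_apply]
  by_cases h1 : x = v <;> by_cases h2 : y = v <;> by_cases h3 : x = w <;> by_cases h4 : y = w <;>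
    simp_all [eq_comm]

end Single

lemma conformal_eq (L : E → ℝ) (g : V → ℝ) (e : E) :
    𝒯.conformal L g e = Real.exp (1 / 2 * 𝒯.endSum g e) * L e := rfl

lemma conformal_pos {L : E → ℝ} {e : E} (hL : 0 < L e) (g : V → ℝ) : 0 < 𝒯.conformal L g e :=
  mul_pos (Real.exp_pos _) hL

variable {𝒯}

lemma IsMetric.realizes_realization {ℓ : E → ℝ} (h : 𝒯.IsMetric ℓ) (t : T) :
    𝒯.Realizes ℓ t (𝒯.realization ℓ t) :=
  Classical.epsilon_spec (h.2 t)

variable (𝒯)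

lemma hasLineDerivAt_conformal (L : E → ℝ) (g h : V → ℝ) (e : E) :
    HasLineDerivAt ℝ (fun g => 𝒯.conformal L g e)
      (1 / 2 * 𝒯.endSum h e * 𝒯.conformal L g e) g h := by
  have h1 : HasDerivAt (fun r : ℝ => 1 / 2 * (𝒯.endSum g e + r * 𝒯.endSum h e))
      (1 / 2 * (1 * 𝒯.endSum h e)) 0 :=
    (((hasDerivAt_id (0 : ℝ)).mul_const _).const_add _).const_mul _
  have h2 := h1.exp.mul_const (L e)
  unfold HasLineDerivAt
  simp only [conformal_eq, endSum_add_smul]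
  refine h2.congr_deriv ?_
  simp only [zero_mul, add_zero]
  ring

variable [Fintype V]

lemma contDiff_conformal (L : E → ℝ) (e : E) {n : WithTop ℕ∞} :
    ContDiff ℝ n (fun g => 𝒯.conformal L g e) := by
  obtain ⟨v, w, -, hz⟩ := 𝒯.exists_ends_eq e
  simp only [conformal_eq, endSum, hz, Sym2.lift_mk]
  fun_prop

lemma eventually_isMetric [Finite T] {L : E → ℝ} (hL : ∀ e, 0 < L e) {f : V → ℝ}
    (hf : 𝒯.IsMetric (𝒯.conformal L f)) : ∀ᶠ g in 𝓝 f, 𝒯.IsMetric (𝒯.conformal L g) := by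
  have h : ∀ t, ∀ᶠ g in 𝓝 f, ∃ s : Tetra, 𝒯.Realizes (𝒯.conformal L g) t s := fun t => by
    have hs := hf.realizes_realization t
    set s := 𝒯.realization (𝒯.conformal L f) t
    have hs' : s.edgeLengths = fun a => 𝒯.conformal L f (𝒯.edge t a) := funext hs
    have hc : Continuous fun g => fun a => 𝒯.conformal L g (𝒯.edge t a) :=
      continuous_pi fun a => (𝒯.contDiff_conformal L _ (n := 0)).continuous
    have h1 := s.eventually_exists_edgeLengths_eq
    rw [hs'] at h1
    filter_upwards [hc.continuousAt.eventually h1] with g ⟨s', h'⟩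
    exact ⟨s', congrFun h'⟩
  filter_upwards [Filter.eventually_all.2 h] with g hg
  exact ⟨fun e => 𝒯.conformal_pos (hL e) g, hg⟩

end Triangulation3

lemma Tetra.exists_edge {i j : Fin 4} (h : i ≠ j) :
    ∃ a, (Tetra.iv a = i ∧ Tetra.jv a = j) ∨ (Tetra.iv a = j ∧ Tetra.jv a = i) := by
  revert i j; decide

/-! ### Variation of the edge curvatures and of the total length -/

namespace Triangulation3

variable {V E T : Type*} (𝒯 : Triangulation3 V E T)

/-- The chosen realizations need not vary continuously, but their distances are the conformal
lengths wherever these form a metric, hence on a neighborhood. -/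
lemma contDiffAt_dist_sq_realization [Fintype V] [Finite T] {L : E → ℝ}
    (hL : ∀ e, 0 < L e) {g : V → ℝ} (hg : 𝒯.IsMetric (𝒯.conformal L g))
    (t : T) (i j : Fin 4) {n : WithTop ℕ∞} :
    ContDiffAt ℝ n (fun g => dist ((𝒯.realization (𝒯.conformal L g) t).points i)
      ((𝒯.realization (𝒯.conformal L g) t).points j) ^ 2) g := by
  by_cases hij : i = j
  · subst hij
    simp only [dist_self]
    exact contDiffAt_const
  · obtain ⟨a, ha⟩ := Tetra.exists_edge hij
    refine ((𝒯.contDiff_conformal L (𝒯.edge t a)).pow 2).contDiffAt.congr_of_eventuallyEq ?_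
    filter_upwards [𝒯.eventually_isMetric hL hg] with g' hg'
    rw [← hg'.realizes_realization t a]
    rcases ha with ⟨rfl, rfl⟩ | ⟨rfl, rfl⟩
    · rfl
    · rw [dist_comm]

lemma hasLineDerivAt_dist_sq_realization [Fintype V] [Finite T] {L : E → ℝ}
    (hL : ∀ e, 0 < L e) {g : V → ℝ} (hg : 𝒯.IsMetric (𝒯.conformal L g))
    (t : T) (i j : Fin 4) (h : V → ℝ) :
    HasLineDerivAt ℝ (fun g => dist ((𝒯.realization (𝒯.conformal L g) t).points i)
      ((𝒯.realization (𝒯.conformal L g) t).points j) ^ 2)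
      (dist ((𝒯.realization (𝒯.conformal L g) t).points i)
        ((𝒯.realization (𝒯.conformal L g) t).points j) ^ 2 *
        (h (𝒯.vert t i) + h (𝒯.vert t j))) g h := by
  by_cases hij : i = j
  · subst hij
    simp only [dist_self]
    rw [zero_pow two_ne_zero, zero_mul]
    exact hasDerivAt_const (0 : ℝ) (0 : ℝ)
  · obtain ⟨a, ha⟩ := Tetra.exists_edge hij
    have hd : ∀ {g'}, 𝒯.IsMetric (𝒯.conformal L g') →
        dist ((𝒯.realization (𝒯.conformal L g') t).points i)
          ((𝒯.realization (𝒯.conformal L g') t).points j) =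
        𝒯.conformal L g' (𝒯.edge t a) := fun {g'} hg' => by
      rw [← hg'.realizes_realization t a]
      rcases ha with ⟨rfl, rfl⟩ | ⟨rfl, rfl⟩
      · rfl
      · rw [dist_comm]
    have hs : h (𝒯.vert t i) + h (𝒯.vert t j) = 𝒯.endSum h (𝒯.edge t a) := by
      rw [endSum_edge]
      rcases ha with ⟨rfl, rfl⟩ | ⟨rfl, rfl⟩
      · rfl
      · rw [add_comm]
    have h1 : HasLineDerivAt ℝ (fun g => 𝒯.conformal L g (𝒯.edge t a) ^ 2)
        (𝒯.conformal L g (𝒯.edge t a) ^ 2 * 𝒯.endSum h (𝒯.edge t a)) g h := by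
      have h2 := HasDerivAt.fun_pow (𝒯.hasLineDerivAt_conformal L g h (𝒯.edge t a)) 2
      refine h2.congr_deriv ?_
      simp only [zero_smul, add_zero]
      ring
    rw [hs, hd hg]
    refine h1.congr_of_eventuallyEq ?_
    filter_upwards [𝒯.eventually_isMetric hL hg] with g' hg'
    rw [hd hg']

lemma exists_hasLineDerivAt_dihedral [Fintype V] [Finite T] {L : E → ℝ}
    (hL : ∀ e, 0 < L e) {g : V → ℝ} (hg : 𝒯.IsMetric (𝒯.conformal L g)) (t : T) (h : V → ℝ) :
    ∃ θ : Fin 6 → ℝ, (∀ a, HasLineDerivAt ℝ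
        (fun g => (𝒯.realization (𝒯.conformal L g) t).dihedral a) (θ a) g h) ∧
      ∀ ψ : V → ℝ, ∑ a, 𝒯.conformal L g (𝒯.edge t a) * θ a * 𝒯.endSum ψ (𝒯.edge t a) =
        -4 * ∑ a, (𝒯.realization (𝒯.conformal L g) t).dualContribution a /
          𝒯.conformal L g (𝒯.edge t a) * 𝒯.endDiffMul ψ h (𝒯.edge t a) := by
  have hline : ContDiffAt ℝ 1 (fun r : ℝ => g + r • h) 0 := by fun_prop
  have h0 : g + (0 : ℝ) • h = g := by rw [zero_smul, add_zero]
  obtain ⟨θ, hθ, hsum⟩ := Tetra.exists_hasDerivAt_dihedral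
    (S := fun r => 𝒯.realization (𝒯.conformal L (g + r • h)) t)
    (φ := fun k => h (𝒯.vert t k))
    (fun i j => by
      have := 𝒯.contDiffAt_dist_sq_realization hL hg t i j (n := 1)
      rw [← h0] at this
      exact this.comp (0 : ℝ) hline)
    (fun i j => by
      have := 𝒯.hasLineDerivAt_dist_sq_realization hL hg t i j h
      simp only [h0]
      exact this)
  refine ⟨θ, hθ, fun ψ => ?_⟩
  have hd : ∀ a, dist _ _ = _ := hg.realizes_realization t
  have := hsum fun k => ψ (𝒯.vert t k)
  simpa only [h0, hd, ← endSum_edge, ← endDiffMul_edge] using this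

/-- The local edges are fibered over the global ones, so a tetrahedron counts once for each of its
local edges glued to `e`. -/
lemma sum_edges_mul [Fintype E] [Fintype T] [DecidableEq E] (F : T → Fin 6 → ℝ) (G : E → ℝ) :
    ∑ e, (∑ t, ∑ a with 𝒯.edge t a = e, F t a) * G e =
      ∑ t, ∑ a, F t a * G (𝒯.edge t a) := by
  simp only [Finset.sum_mul]
  rw [Finset.sum_comm]
  refine Finset.sum_congr rfl fun t _ => ?_
  simp only [Finset.sum_filter]
  rw [Finset.sum_comm]
  refine Finset.sum_congr rfl fun a _ => ?_
  simp

/-- The edge curvatures, integrated against the sum of the values of `ψ` at the endpoints. -/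
lemma sum_edgeCurv_mul_endSum [Fintype E] [Fintype T] [DecidableEq E] (ℓ : E → ℝ) (ψ : V → ℝ) :
    ∑ e, 𝒯.edgeCurv ℓ e * 𝒯.endSum ψ e =
      ∑ e, 2 * Real.pi * (ℓ e * 𝒯.endSum ψ e) - ∑ t, ∑ a, (𝒯.realization ℓ t).dihedral a *
        (ℓ (𝒯.edge t a) * 𝒯.endSum ψ (𝒯.edge t a)) := by
  rw [← 𝒯.sum_edges_mul (fun t a => (𝒯.realization ℓ t).dihedral a)
    (fun e => ℓ e * 𝒯.endSum ψ e), ← Finset.sum_sub_distrib]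
  refine Finset.sum_congr rfl fun e _ => ?_
  rw [edgeCurv]
  ring

lemma contDiffAt_edgeCurv [Fintype V] [Fintype T] [DecidableEq E] {L : E → ℝ}
    (hL : ∀ e, 0 < L e) {g : V → ℝ}
    (hg : 𝒯.IsMetric (𝒯.conformal L g)) (e : E) {n : WithTop ℕ∞} :
    ContDiffAt ℝ n (fun g => 𝒯.edgeCurv (𝒯.conformal L g) e) g := by
  unfold edgeCurv
  refine (contDiffAt_const.sub (ContDiffAt.sum fun t _ => ContDiffAt.sum fun a _ => ?_)).mul
    (𝒯.contDiff_conformal L e).contDiffAt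
  exact Tetra.contDiffAt_dihedral (fun i j => 𝒯.contDiffAt_dist_sq_realization hL hg t i j) a

/-- The derivative of the curvature along a conformal variation. -/
lemma hasLineDerivAt_sum_edgeCurv [Fintype V] [Fintype E] [Fintype T] [DecidableEq E] {L : E → ℝ}
    (hL : ∀ e, 0 < L e) {g : V → ℝ}
    (hg : 𝒯.IsMetric (𝒯.conformal L g)) (ψ h : V → ℝ) :
    HasLineDerivAt ℝ (fun g => ∑ e, 𝒯.edgeCurv (𝒯.conformal L g) e * 𝒯.endSum ψ e)
      (1 / 2 * ∑ e, 𝒯.edgeCurv (𝒯.conformal L g) e * (𝒯.endSum ψ e * 𝒯.endSum h e) +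
        4 * ∑ e, 𝒯.dualLength (𝒯.conformal L g) e / 𝒯.conformal L g e *
          𝒯.endDiffMul ψ h e) g h := by
  have h0 : g + (0 : ℝ) • h = g := by rw [zero_smul, add_zero]
  choose θ hθ hsum using fun t => 𝒯.exists_hasLineDerivAt_dihedral hL hg t h
  have hℓ := 𝒯.hasLineDerivAt_conformal L g h
  simp only [sum_edgeCurv_mul_endSum]
  have hd : HasDerivAt _ _ (0 : ℝ) := HasDerivAt.fun_sub
    (HasDerivAt.fun_sum fun e (_ : e ∈ Finset.univ) =>
      (HasDerivAt.mul_const (hℓ e) (𝒯.endSum ψ e)).const_mul (2 * Real.pi))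
    (HasDerivAt.fun_sum fun t (_ : t ∈ Finset.univ) => HasDerivAt.fun_sum
      fun a (_ : a ∈ Finset.univ) => HasDerivAt.fun_mul (hθ t a)
        (HasDerivAt.mul_const (hℓ (𝒯.edge t a)) (𝒯.endSum ψ (𝒯.edge t a))))
  refine hd.congr_deriv ?_
  simp only [h0, Finset.sum_add_distrib]
  have e1 : ∑ e, 𝒯.edgeCurv (𝒯.conformal L g) e * (𝒯.endSum ψ e * 𝒯.endSum h e) =
      ∑ e, 2 * Real.pi * (𝒯.conformal L g e * (𝒯.endSum ψ e * 𝒯.endSum h e)) -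
      ∑ t, ∑ a, (𝒯.realization (𝒯.conformal L g) t).dihedral a * (𝒯.conformal L g (𝒯.edge t a) *
        (𝒯.endSum ψ (𝒯.edge t a) * 𝒯.endSum h (𝒯.edge t a))) := by
    rw [← 𝒯.sum_edges_mul (fun t a => (𝒯.realization (𝒯.conformal L g) t).dihedral a)
      (fun e => 𝒯.conformal L g e * (𝒯.endSum ψ e * 𝒯.endSum h e)), ← Finset.sum_sub_distrib]
    refine Finset.sum_congr rfl fun e _ => ?_
    rw [edgeCurv]
    ring
  have e2 : ∑ e, 𝒯.dualLength (𝒯.conformal L g) e / 𝒯.conformal L g e * 𝒯.endDiffMul ψ h e =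
      ∑ t, ∑ a, (𝒯.realization (𝒯.conformal L g) t).dualContribution a /
        𝒯.conformal L g (𝒯.edge t a) * 𝒯.endDiffMul ψ h (𝒯.edge t a) := by
    simp only [div_mul_eq_mul_div, mul_div_assoc]
    exact 𝒯.sum_edges_mul (fun t a => (𝒯.realization (𝒯.conformal L g) t).dualContribution a)
      (fun e => 𝒯.endDiffMul ψ h e / 𝒯.conformal L g e)
  -- The contribution of the varying angles. Angles enter the curvature with a minus sign, whence
  -- the `+4` in the result.
  have e3 : ∑ t, ∑ a, θ t a * (𝒯.conformal L g (𝒯.edge t a) * 𝒯.endSum ψ (𝒯.edge t a)) =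
      -4 * ∑ e, 𝒯.dualLength (𝒯.conformal L g) e / 𝒯.conformal L g e *
        𝒯.endDiffMul ψ h e := by
    rw [e2, Finset.mul_sum]
    refine Finset.sum_congr rfl fun t _ => ?_
    rw [← hsum]
    exact Finset.sum_congr rfl fun a _ => by ring
  rw [e3, e1, mul_sub, Finset.mul_sum, Finset.mul_sum]
  simp only [Finset.mul_sum]
  have e4 : ∀ e, 2 * Real.pi * (1 / 2 * 𝒯.endSum h e * 𝒯.conformal L g e * 𝒯.endSum ψ e) =
      1 / 2 * (2 * Real.pi * (𝒯.conformal L g e * (𝒯.endSum ψ e * 𝒯.endSum h e))) :=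
    fun e => by ring
  have e5 : ∀ t a, (𝒯.realization (𝒯.conformal L g) t).dihedral a *
      (1 / 2 * 𝒯.endSum h (𝒯.edge t a) * 𝒯.conformal L g (𝒯.edge t a) *
        𝒯.endSum ψ (𝒯.edge t a)) = 1 / 2 * ((𝒯.realization (𝒯.conformal L g) t).dihedral a *
      (𝒯.conformal L g (𝒯.edge t a) * (𝒯.endSum ψ (𝒯.edge t a) *
        𝒯.endSum h (𝒯.edge t a)))) := fun t a => by ring
  simp only [e4, e5]
  simp only [← Finset.mul_sum]
  ring

/-- The case `ψ = 1`: all differences along edges vanish, so the angles contribute nothing, which is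
Schläfli's formula. -/
lemma hasLineDerivAt_EHR [Fintype V] [Fintype E] [Fintype T] [DecidableEq E] {L : E → ℝ}
    (hL : ∀ e, 0 < L e) {g : V → ℝ}
    (hg : 𝒯.IsMetric (𝒯.conformal L g)) (h : V → ℝ) :
    HasLineDerivAt ℝ (fun g => 𝒯.EHR (𝒯.conformal L g))
      (1 / 2 * ∑ e, 𝒯.edgeCurv (𝒯.conformal L g) e * 𝒯.endSum h e) g h := by
  have h1 := HasDerivAt.const_mul (1 / 2 : ℝ)
    (𝒯.hasLineDerivAt_sum_edgeCurv hL hg (fun _ => 1) h)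
  have h2 : (fun r : ℝ => 𝒯.EHR (𝒯.conformal L (g + r • h))) = fun r : ℝ => 1 / 2 *
      ∑ e, 𝒯.edgeCurv (𝒯.conformal L (g + r • h)) e * 𝒯.endSum (fun _ => 1) e := by
    funext r
    simp only [endSum_one, ← Finset.sum_mul, EHR]
    ring
  unfold HasLineDerivAt
  rw [h2]
  refine h1.congr_deriv ?_
  simp only [endSum_one, endDiffMul_one, mul_zero, Finset.sum_const_zero, add_zero,
    mul_left_comm _ (2 : ℝ), ← Finset.mul_sum]
  ring

lemma hasLineDerivAt_sum_conformal [Fintype E] (L : E → ℝ) (g ψ h : V → ℝ) :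
    HasLineDerivAt ℝ (fun g => ∑ e, 𝒯.conformal L g e * 𝒯.endSum ψ e)
      (1 / 2 * ∑ e, 𝒯.conformal L g e * (𝒯.endSum ψ e * 𝒯.endSum h e)) g h := by
  have h1 : HasDerivAt _ _ (0 : ℝ) := HasDerivAt.fun_sum fun e (_ : e ∈ Finset.univ) =>
    HasDerivAt.mul_const (𝒯.hasLineDerivAt_conformal L g h e) (𝒯.endSum ψ e)
  refine h1.congr_deriv ?_
  rw [Finset.mul_sum]
  exact Finset.sum_congr rfl fun e _ => by ring

lemma hasLineDerivAt_totalLength [Fintype E] (L : E → ℝ) (g h : V → ℝ) :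
    HasLineDerivAt ℝ (fun g => totalLength (𝒯.conformal L g))
      (1 / 2 * ∑ e, 𝒯.conformal L g e * 𝒯.endSum h e) g h := by
  have h1 : HasDerivAt _ _ (0 : ℝ) := HasDerivAt.fun_sum fun e (_ : e ∈ Finset.univ) =>
    𝒯.hasLineDerivAt_conformal L g h e
  refine h1.congr_deriv ?_
  rw [Finset.mul_sum]
  exact Finset.sum_congr rfl fun e _ => by ring

end Triangulation3

/-! ### First and second variation of `LEHR` -/

namespace Triangulation3

variable {V E T : Type*} (𝒯 : Triangulation3 V E T)

lemma contDiffAt_LEHR [Fintype V] [Fintype E] [Fintype T] [DecidableEq E] {L : E → ℝ}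
    (hL : ∀ e, 0 < L e) {g : V → ℝ} (hg : 𝒯.IsMetric (𝒯.conformal L g)) {n : WithTop ℕ∞} :
    ContDiffAt ℝ n (fun g => 𝒯.LEHR (𝒯.conformal L g)) g := by
  rcases isEmpty_or_nonempty E with hE | hE
  · simp only [LEHR, EHR, Finset.univ_eq_empty, Finset.sum_empty, zero_div]
    exact contDiffAt_const
  · unfold LEHR EHR totalLength
    refine (ContDiffAt.sum fun e _ => 𝒯.contDiffAt_edgeCurv hL hg e).div
      (ContDiffAt.sum fun e _ => (𝒯.contDiff_conformal L e).contDiffAt) ?_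
    exact (Finset.sum_pos (fun e _ => 𝒯.conformal_pos (hL e) g) Finset.univ_nonempty).ne'

lemma totalLength_conformal_pos [Fintype E] [Nonempty E] {L : E → ℝ} (hL : ∀ e, 0 < L e)
    (g : V → ℝ) : 0 < totalLength (𝒯.conformal L g) :=
  Finset.sum_pos (fun e _ => 𝒯.conformal_pos (hL e) g) Finset.univ_nonempty

section

variable [Fintype E] [DecidableEq V]

lemma vertexLength_eq (ℓ : E → ℝ) (v : V) :
    𝒯.vertexLength ℓ v = 1 / 2 * ∑ e, ℓ e * 𝒯.endSum (Pi.single v 1) e := by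
  simp only [vertexLength, endSum_single, mul_ite, mul_one, mul_zero, Finset.sum_filter]

lemma vertexCurv_eq [Fintype T] [DecidableEq E] (ℓ : E → ℝ) (v : V) :
    𝒯.vertexCurv ℓ v = 1 / 2 * ∑ e, 𝒯.edgeCurv ℓ e * 𝒯.endSum (Pi.single v 1) e := by
  simp only [vertexCurv, endSum_single, mul_ite, mul_one, mul_zero, Finset.sum_filter]

lemma laplacian_eq [Fintype T] [DecidableEq E] (ℓ : E → ℝ) (v w : V) : 𝒯.laplacian ℓ v w =
    -∑ e, 𝒯.dualLength ℓ e / ℓ e * 𝒯.endDiffMul (Pi.single v 1) (Pi.single w 1) e := by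
  simp only [laplacian, Matrix.of_apply, endDiffMul_single]
  split_ifs <;> simp [Finset.sum_filter]

lemma nMatrix_eq [Fintype T] [DecidableEq E] (ℓ : E → ℝ) (v w : V) : 𝒯.nMatrix ℓ v w =
    1 / 4 * ∑ e, (𝒯.edgeCurv ℓ e - 𝒯.LEHR ℓ * ℓ e) *
      (𝒯.endSum (Pi.single v 1) e * 𝒯.endSum (Pi.single w 1) e) := by
  simp only [nMatrix, Matrix.of_apply, endSum_single_mul_single, vertexCurv, vertexLength]
  split_ifs
  · simp only [mul_ite, mul_one, mul_zero, ← Finset.sum_filter, Finset.sum_sub_distrib,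
      ← Finset.mul_sum]
    ring
  · simp only [mul_ite, mul_one, mul_zero, ← Finset.sum_filter, Finset.mul_sum]

lemma sum_mul_endSum_single [Fintype V] (F : E → ℝ) :
    ∑ v, ∑ e, F e * 𝒯.endSum (Pi.single v 1) e = 2 * ∑ e, F e := by
  rw [Finset.sum_comm, Finset.mul_sum]
  refine Finset.sum_congr rfl fun e _ => ?_
  rw [← Finset.mul_sum, mul_comm]
  congr 1
  obtain ⟨x, y, -, hz⟩ := 𝒯.exists_ends_eq e
  simp only [endSum, hz, Sym2.lift_mk, Finset.sum_add_distrib]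
  simp [Pi.single_apply]
  norm_num

/-- The constant in the definition of constant `𝓛`-scalar curvature is `LEHR`. -/
lemma ConstLScalarCurv.vertexCurv_eq_LEHR [Fintype V] [Fintype T] [DecidableEq E] {ℓ : E → ℝ}
    (h : 𝒯.ConstLScalarCurv ℓ) (hℓ : totalLength ℓ ≠ 0) (v : V) :
    𝒯.vertexCurv ℓ v = 𝒯.LEHR ℓ * 𝒯.vertexLength ℓ v := by
  obtain ⟨c, hc⟩ := h
  -- Each edge is counted with weight one half at each of its two endpoints.
  have h1 : ∑ v, 𝒯.vertexCurv ℓ v = 𝒯.EHR ℓ := by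
    simp only [vertexCurv_eq, ← Finset.mul_sum, sum_mul_endSum_single, EHR]
    ring
  have h2 : ∑ v, 𝒯.vertexLength ℓ v = totalLength ℓ := by
    simp only [vertexLength_eq, ← Finset.mul_sum, sum_mul_endSum_single, totalLength]
    ring
  have h3 : 𝒯.EHR ℓ = c * totalLength ℓ := by
    rw [← h1, ← h2, Finset.mul_sum]
    exact Finset.sum_congr rfl fun v _ => hc v
  rw [hc, LEHR, h3, mul_div_cancel_right₀ _ hℓ]

/-- The first variation of the length normalized Einstein-Hilbert-Regge functional. -/
lemma partialDeriv_LEHR [Fintype V] [Fintype T] [DecidableEq E] [Nonempty E] {L : E → ℝ}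
    (hL : ∀ e, 0 < L e) {g : V → ℝ} (hg : 𝒯.IsMetric (𝒯.conformal L g)) (v : V) :
    partialDeriv (fun g => 𝒯.LEHR (𝒯.conformal L g)) v g =
      (𝒯.vertexCurv (𝒯.conformal L g) v * totalLength (𝒯.conformal L g) -
        𝒯.EHR (𝒯.conformal L g) * 𝒯.vertexLength (𝒯.conformal L g) v) /
        totalLength (𝒯.conformal L g) ^ 2 := by
  have h0 : g + (0 : ℝ) • (Pi.single v 1 : V → ℝ) = g := by rw [zero_smul, add_zero]
  have hd := HasDerivAt.fun_div (𝒯.hasLineDerivAt_EHR hL hg (Pi.single v 1))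
    (𝒯.hasLineDerivAt_totalLength L g (Pi.single v 1))
    (𝒯.totalLength_conformal_pos hL _).ne'
  rw [partialDeriv, lineDeriv]
  refine hd.deriv.trans ?_
  rw [h0, vertexCurv_eq, vertexLength_eq]

/-- The second variation at a metric of constant `𝓛`-scalar curvature. -/
lemma partialDeriv_partialDeriv_LEHR [Fintype V] [Fintype T] [DecidableEq E] [Nonempty E]
    {L : E → ℝ} (hL : ∀ e, 0 < L e) {f : V → ℝ} (hf : 𝒯.IsMetric (𝒯.conformal L f))
    (hcsc : 𝒯.ConstLScalarCurv (𝒯.conformal L f)) (v w : V) :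
    partialDeriv (partialDeriv (fun g => 𝒯.LEHR (𝒯.conformal L g)) w) v f =
      -(2 / totalLength (𝒯.conformal L f)) * 𝒯.laplacian (𝒯.conformal L f) v w +
      (1 / totalLength (𝒯.conformal L f)) * 𝒯.nMatrix (𝒯.conformal L f) v w := by
  have h0 : f + (0 : ℝ) • (Pi.single v 1 : V → ℝ) = f := by rw [zero_smul, add_zero]
  have hpos := 𝒯.totalLength_conformal_pos hL f
  -- The formula for the first derivative is available only at metrics; openness makes it valid near
  -- `f`, which is enough to differentiate again.
  have hfirst : partialDeriv (fun g => 𝒯.LEHR (𝒯.conformal L g)) w =ᶠ[𝓝 f] fun g =>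
      (𝒯.vertexCurv (𝒯.conformal L g) w * totalLength (𝒯.conformal L g) -
        𝒯.EHR (𝒯.conformal L g) * 𝒯.vertexLength (𝒯.conformal L g) w) /
        totalLength (𝒯.conformal L g) ^ 2 :=
    (𝒯.eventually_isMetric hL hf).mono fun g hg => 𝒯.partialDeriv_LEHR hL hg w
  rw [partialDeriv, hfirst.lineDeriv_eq, lineDeriv]
  simp only [vertexCurv_eq, vertexLength_eq]
  have hK := HasDerivAt.const_mul (1 / 2 : ℝ)
    (𝒯.hasLineDerivAt_sum_edgeCurv hL hf (Pi.single w 1) (Pi.single v 1))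
  have hl := HasDerivAt.const_mul (1 / 2 : ℝ)
    (𝒯.hasLineDerivAt_sum_conformal L f (Pi.single w 1) (Pi.single v 1))
  have hE := 𝒯.hasLineDerivAt_EHR hL hf (Pi.single v 1)
  have hT := 𝒯.hasLineDerivAt_totalLength L f (Pi.single v 1)
  have hd := ((hK.fun_mul hT).fun_sub (HasDerivAt.fun_mul hE hl)).fun_div
    (HasDerivAt.fun_pow hT 2) (pow_ne_zero 2 (𝒯.totalLength_conformal_pos hL _).ne')
  refine hd.deriv.trans ?_
  have hw := hcsc.vertexCurv_eq_LEHR 𝒯 hpos.ne' w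
  have hv := hcsc.vertexCurv_eq_LEHR 𝒯 hpos.ne' v
  have hS : 𝒯.EHR (𝒯.conformal L f) = 𝒯.LEHR (𝒯.conformal L f) * totalLength (𝒯.conformal L f) :=
    (div_mul_cancel₀ _ hpos.ne').symm
  rw [vertexCurv_eq, vertexLength_eq] at hw hv
  rw [nMatrix_eq, laplacian_eq, h0]
  beta_reduce
  -- Now the numerator of the first variation is zero, so the derivative of the denominator drops
  -- out, and the cross terms `K_w L_v` and `K_v L_w` cancel.
  rw [hw, hv, hS]
  have hD : ∀ e, 𝒯.endDiffMul (Pi.single w 1) (Pi.single v 1) e =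
      𝒯.endDiffMul (Pi.single v 1) (Pi.single w 1) e := fun e => by
    obtain ⟨x, y, -, hz⟩ := 𝒯.exists_ends_eq e
    simp only [endDiffMul, hz, Sym2.lift_mk, mul_comm]
  have hN : ∑ e, (𝒯.edgeCurv (𝒯.conformal L f) e - 𝒯.LEHR (𝒯.conformal L f) *
      𝒯.conformal L f e) * (𝒯.endSum (Pi.single v 1) e * 𝒯.endSum (Pi.single w 1) e) =
      ∑ e, 𝒯.edgeCurv (𝒯.conformal L f) e *
        (𝒯.endSum (Pi.single w 1) e * 𝒯.endSum (Pi.single v 1) e) -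
      𝒯.LEHR (𝒯.conformal L f) * ∑ e, 𝒯.conformal L f e *
        (𝒯.endSum (Pi.single w 1) e * 𝒯.endSum (Pi.single v 1) e) := by
    rw [Finset.mul_sum, ← Finset.sum_sub_distrib]
    exact Finset.sum_congr rfl fun e _ => by ring
  simp only [hD, hN]
  have hne := hpos.ne'
  field_simp
  ring

end

end Triangulation3

end

theorem proposition4p16 {V E T : Type*} [Fintype V] [Fintype E] [Fintype T]
    [DecidableEq V] [DecidableEq E] (𝒯 : Triangulation3 V E T)
    (L : E → ℝ) (hL : 𝒯.IsMetric L)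
    (f : V → ℝ) (hf : 𝒯.IsMetric (𝒯.conformal L f))
    (hcsc : 𝒯.ConstLScalarCurv (𝒯.conformal L f)) :
    (∀ᶠ g in 𝓝 f, 𝒯.IsMetric (𝒯.conformal L g)) ∧
    ContDiffAt ℝ 2 (fun g => 𝒯.LEHR (𝒯.conformal L g)) f ∧
    ∀ v v' : V,
      Triangulation3.partialDeriv
        (Triangulation3.partialDeriv (fun g => 𝒯.LEHR (𝒯.conformal L g)) v') v f =
      -(2 / Triangulation3.totalLength (𝒯.conformal L f)) * 𝒯.laplacian (𝒯.conformal L f) v v' +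
      (1 / Triangulation3.totalLength (𝒯.conformal L f)) * 𝒯.nMatrix (𝒯.conformal L f) v v' := by
  refine ⟨𝒯.eventually_isMetric hL.1 hf, 𝒯.contDiffAt_LEHR hL.1 hf, fun v v' => ?_⟩
  rcases isEmpty_or_nonempty E with hE | hE
  -- Without edges the total length is 0, and division by it is 0 on both sides.
  · have h0 : (fun g => 𝒯.LEHR (𝒯.conformal L g)) = 0 := by
      funext g
      simp [Triangulation3.LEHR, Triangulation3.EHR]
    have h1 : Triangulation3.partialDeriv (0 : (V → ℝ) → ℝ) v' = 0 := by
      funext g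
      exact (hasDerivAt_const (0 : ℝ) (0 : ℝ)).deriv
    rw [h0, h1, Triangulation3.totalLength, Finset.univ_eq_empty, Finset.sum_empty]
    simp only [div_zero, neg_zero, zero_mul, add_zero]
    exact (hasDerivAt_const (0 : ℝ) (0 : ℝ)).deriv
  · exact 𝒯.partialDeriv_partialDeriv_LEHR hL.1 hf hcsc v v'
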